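/- **Setting.** A surface is a closed connected orientable $2$-manifold. A p-A (generalized pseudo-Anosov) homeomorphism of a surface $S$ is an orientation-preserving homeomorphism $f:S\to S$ with $\lambda>1$ and a transverse pair of $f$-invariant measured foliations $(\mathcal F^s,\mu^s),(\mathcal F^u,\mu^u)$ with finitely many $k$-prong singularities ($k\ge 1$, $k\neq 2$; one-prongs allowed), such that $f$ multiplies $\mu^s$ by $\lambda$ and $\mu^u$ by $\lambda^{-1}$. $\mathrm{Sing}(f)$ is the set of singularities; if the foliations have none, $\mathrm{Sing}(f)$ is a chosen non-empty finite $f$-invariant set (of periodic points). The leaf of a singularity is its union with all its separatrices. Arcs are compact and non-degenerate; stable (unstable) arcs are arcs contained in a stable (unstable) leaf. **First intersection points and graphs.** A point $z\notin\mathrm{Sing}(f)$ is a *first intersection point* of $f$ if there are $p,q\in \mathrm{Sing}(f)$, a stable arc $[p,z]^s$ and an unstable arc $[q,z]^u$ with $(p,z]^s\cap(q,z]^u=\{z\}$. Put $J^u(z)=[q,z]^u$ and $\mathcal J^u(z)=\bigcup_{i\ge0}f^{-i}(J^u(z))$. Let $\delta^s(z)$ be the family of all stable arcs with one endpoint in $\mathrm{Sing}(f)$,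 the other in $\mathcal J^u(z)$, and interior disjoint from $\mathcal J^u(z)$; let $\delta^u(z)$ be the family of all unstable arcs with one endpoint in $\mathrm{Sing}(f)$, the other in $\cup\delta^s(z)$, and interior disjoint from $\cup\delta^s(z)$. **Rails.** For a family $\delta$ of stable arcs, its regular part is $\cup\delta$ minus the endpoints of its arcs. A *regular $u$-rail* of $\delta$ is an unstable arc with endpoints in the regular part and interior disjoint from $\cup\delta$. An embedded rectangle is a homeomorphic image of $[0,1]^2$ whose horizontal (vertical) segments lie in stable (unstable) leaves. An *extreme $u$-rail* of $\delta$ is an unstable arc $J$ with an endpoint outside the regular part which is a vertical side of an embedded rectangle whose horizontal sides lie in $\cup\delta$ and all of whose other vertical segments are regular $u$-rails. Two regular $u$-rails are equivalent if they are joined by a finite chain in which consecutive rails are vertical segments of an embedded rectangle whose horizontal sides lie in $\cup\delta$ and all of whose vertical segments are regular $u$-rails. The $s$-rails of a family of unstable arcs, and their classes, are defined by exchanging the roles of the foliations. **Compatibility.** $\delta^s(z)$ and $f^n(\delta^u(z))$ are *compatible* if the endpoints of the arcs of each family lie in the union of the other, the extreme $u$-rails of $\delta^s(z)$ are contained in $\cup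 f^n(\delta^u(z))$, and the extreme $s$-rails of $f^n(\delta^u(z))$ are contained in $\cup\delta^s(z)$. The *compatibility coefficient* $n(z)$ is the least $N$ such that they are compatible for all $n\ge N$. **Markov partitions.** An open connected set $r\ne\emptyset$ is trivially bi-foliated if for all $x,y\in r$ the closures $I_x$, $J_y$ of the components through $x$, $y$ of the traces on $r$ of the stable leaf of $x$ and the unstable leaf of $y$ are arcs which meet in exactly one point, and this point is in $r$. Then $R=\overline r$ is a rectangle with interior $r$. A rectangle with interior $c\subset r$ is a horizontal (vertical) subrectangle of $R$ if through every point of $c$ the stable (unstable) traces on $c$ and on $r$ have the same component. A Markov partition of $f$ is a finite cover $\{R_i\}$ of $S$ by rectangles with pairwise disjoint interiors $r_i$ such that every component of $r_i\cap f^{-1}(r_j)$ (of $f(r_i)\cap r_j$) is the interior of a horizontal subrectangle of $R_i$ (a vertical subrectangle of $R_j$). $\mathcal R(z,n)$ denotes the family of closures of the connected components of $S\setminus\big(\cup\delta^s(z)\ \cup\ \cup f^n(\delta^u(z))\big)$; when $z$ is a first intersection point, $n\ge n(z)$ and this family is a Markov partition, it is called the primitive Markov partition of $f$ generated by $z$ of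 order $n$. **Proposition.** Let $f:S_f\to S_f$ and $g:S_g\to S_g$ be p-A homeomorphisms and $h:S_f\to S_g$ a homeomorphism with $g=h\circ f\circ h^{-1}$; if the foliations of $f$ have no singularities, assume also that $h(\mathrm{Sing}(f))=\mathrm{Sing}(g)$ for the chosen sets. Let $z$ be a first intersection point of $f$. Then: 1. $h(z)$ is a first intersection point of $g$. 2. $h(\mathcal J^u(z))=\mathcal J^u(h(z))$. 3. $h(\delta^s(z))=\delta^s(h(z))$ and $h(\delta^u(z))=\delta^u(h(z))$. Moreover $h$ maps the set of regular (extreme) $u$-rails of $\delta^s(z)$ onto that of $\delta^s(h(z))$ and, for all $n\ge0$, the set of regular (extreme) $s$-rails of $f^n(\delta^u(z))$ onto that of $g^n(\delta^u(h(z)))$. 4. For all $n\ge0$, $\delta^s(z)$ is compatible with $f^n(\delta^u(z))$ if and only if $\delta^s(h(z))$ is compatible with $g^n(\delta^u(h(z)))$. 5. A number $N$ is the compatibility coefficient of $z$ if and only if it is that of $h(z)$; that is, $n(z)=n(h(z))$. 6. $h$ maps the set of classes of $u$-rails of $\delta^s(z)$ onto that of $\delta^s(h(z))$ and, for all $n\ge0$,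 the set of classes of $s$-rails of $f^n(\delta^u(z))$ onto that of $g^n(\delta^u(h(z)))$. 7. $h(\mathcal R(z,n))=\mathcal R(h(z),n)$ for every $n\ge 0$, in particular for every $n\ge n(z)=n(h(z))$. Moreover, for every $n$, a family $\mathcal R$ is the primitive Markov partition of $f$ generated by $z$ of order $n$ if and only if $h(\mathcal R)$ is the primitive Markov partition of $g$ generated by $h(z)$ of order $n$. -/

import Mathlib

open Set Filter Topology

/-! ### Measured foliations and pseudo-Anosov homeomorphisms -/

/-- A transverse pair of measured foliations `(𝓕ˢ, μˢ)`, `(𝓕ᵘ, μᵘ)` with prong singularities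
(one-prongs, i.e. spines, are allowed) on an oriented topological surface `S`, given by natural
charts.

Every point `p` has a prong number `k = prong p ≥ 1` and a chart `φ = chart p` centred at `p`.  On
the domain of `φ` the function `w = φ ^ (k / 2)`, which away from `p` has two local branches `± w`,
is a natural coordinate: `𝓕ˢ` is `{Im w = const}`, with transverse measure `μˢ = |d Im w|`, and
`𝓕ᵘ` is `{Re w = const}`, with transverse measure `μᵘ = |d Re w|`.  So `p` is a regular point if
and only if `k = 2`, and otherwise it is a `k`-prong singularity.

The field `compatible` says that all these local pictures fit together: a point `x ≠ p` in the
domain of the chart at `p` is regular, and near `x` the coordinate centred at `x` is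
`± (chart p) ^ (k / 2) + c`.  Thus natural coordinates change by `w ↦ ± w + c`, and these maps
preserve the two foliations, the two transverse measures and the orientation. -/
structure MeasuredFoliations (S : Type*) [TopologicalSpace S] where
  prong : S → ℕ
  prong_pos : ∀ p, 1 ≤ prong p
  chart : S → OpenPartialHomeomorph S ℂ
  mem_source : ∀ p, p ∈ (chart p).source
  chart_self : ∀ p, chart p p = 0
  compatible : ∀ p, ∀ x ∈ (chart p).source, x ≠ p →
    prong x = 2 ∧ ∃ c : ℂ, ∀ᶠ y in 𝓝 x, (chart x y - c) ^ 2 = (chart p y) ^ (prong p)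

namespace MeasuredFoliations

variable {S : Type*} [TopologicalSpace S] (𝓕 : MeasuredFoliations S)

/-- The local stable leaf of `p` in the chart at `p`: the set `Im (z ^ (k / 2)) = 0`, i.e. the
centre and the `k` horizontal prongs. -/
def stablePlaque (p : S) : Set S :=
  {y | y ∈ (𝓕.chart p).source ∧ ∃ r : ℝ, 0 ≤ r ∧ (𝓕.chart p y) ^ (𝓕.prong p) = (r : ℂ)}

/-- The local unstable leaf of `p` in the chart at `p`: the set `Re (z ^ (k / 2)) = 0`, i.e. the
centre and the `k` vertical prongs. -/
def unstablePlaque (p : S) : Set S :=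
  {y | y ∈ (𝓕.chart p).source ∧ ∃ r : ℝ, 0 ≤ r ∧ (𝓕.chart p y) ^ (𝓕.prong p) = ((-r : ℝ) : ℂ)}

/-- The stable leaf through `x`: the points that can be joined to `x` by a path that locally stays
in stable plaques.  The leaf of a singularity is the union of the singularity and all of its
stable separatrices. -/
def stableLeaf (x : S) : Set S :=
  {y | ∃ γ : Path x y, ∀ t, ∀ᶠ s in 𝓝 t, γ s ∈ 𝓕.stablePlaque (γ t)}

/-- The unstable leaf through `x`. -/
def unstableLeaf (x : S) : Set S :=
  {y | ∃ γ : Path x y, ∀ t, ∀ᶠ s in 𝓝 t, γ s ∈ 𝓕.unstablePlaque (γ t)}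

end MeasuredFoliations

/-- A generalized pseudo-Anosov homeomorphism `f = map` of `S` with stretch factor `lam`, its
invariant foliations and its set `sing` of singular points.

`expands` says that in natural coordinates `f` is `± (x, y) ↦ (lam⁻¹ x, lam y)` up to translation.
So `f` preserves the orientation and both foliations, it stretches `μˢ = |dy|` by the factor `lam`
and `μᵘ = |dx|` by the factor `lam⁻¹`.

`sing` is the set of singularities of the foliations if there are any.  If the foliations have no
singularity, it is a chosen finite non-empty `f`-invariant set, hence a finite family of
periodic points. -/
structure PseudoAnosov (S : Type*) [TopologicalSpace S] extends MeasuredFoliations S where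
  map : S ≃ₜ S
  lam : ℝ
  one_lt_lam : 1 < lam
  prong_map : ∀ x, prong (map x) = prong x
  expands : ∀ x, prong x = 2 → ∃ ε : ℝ, (ε = 1 ∨ ε = -1) ∧ ∀ᶠ y in 𝓝 x,
    chart (map x) (map y) = ⟨ε * lam⁻¹ * (chart x y).re, ε * lam * (chart x y).im⟩
  sing : Set S
  sing_eq : (∃ p, prong p ≠ 2) → sing = {p | prong p ≠ 2}
  sing_finite : sing.Finite
  sing_nonempty : sing.Nonempty
  map_sing : map '' sing = sing

/-! ### Arcs, graphs, rails, rectangles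

Here `L x` is the leaf through `x` of one foliation, and `L' x` that of the other one. -/

section Arcs

variable {S : Type*} [TopologicalSpace S]

/-- `A` is a (non-degenerate) compact arc with endpoints `a` and `b`. -/
def IsArc (A : Set S) (a b : S) : Prop :=
  ∃ γ : unitInterval → S, Continuous γ ∧ Function.Injective γ ∧ γ 0 = a ∧ γ 1 = b ∧ range γ = A

/-- The two endpoints of an arc. -/
def arcEndpoints (A : Set S) : Set S := {a | ∃ b, IsArc A a b}

/-- An arc without its endpoints. -/
def arcInterior (A : Set S) : Set S := A \ arcEndpoints A

/-- `A` is a compact arc with endpoints `a` and `b`, contained in a leaf. -/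
def IsLeafArc (L : S → Set S) (A : Set S) (a b : S) : Prop :=
  IsArc A a b ∧ ∃ x, A ⊆ L x

/-- The graph generated by the set `J`: all leaf arcs with one endpoint in `P` and the
other in `J`, with interior disjoint from `J`. -/
def generatedGraph (L : S → Set S) (P J : Set S) : Set (Set S) :=
  {A | ∃ p ∈ P, ∃ x ∈ J, IsLeafArc L A p x ∧ Disjoint (arcInterior A) J}

/-- The endpoints of the arcs of a graph. -/
def graphEndpoints (δ : Set (Set S)) : Set S := {a | ∃ A ∈ δ, a ∈ arcEndpoints A}

/-- The regular part of a graph. -/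
def regularPart (δ : Set (Set S)) : Set S := ⋃₀ δ \ graphEndpoints δ

/-- The regular rails of a graph `δ`: arcs in leaves of `L'` whose interior is disjoint from `⋃ δ`
and whose endpoints lie in the regular part of `δ`.  (`L'` is the foliation transverse to `δ`.) -/
def regularRails (L' : S → Set S) (δ : Set (Set S)) : Set (Set S) :=
  {J | ∃ a ∈ regularPart δ, ∃ b ∈ regularPart δ,
    IsLeafArc L' J a b ∧ Disjoint (arcInterior J) (⋃₀ δ)}

/-- `ρ` is a parametrization of an embedded rectangle: it is a homeomorphism of the unit square
onto its image, it sends horizontal segments into leaves of `L` and vertical ones into leaves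
of `L'`. -/
def IsEmbeddedRectangle (L L' : S → Set S) (ρ : unitInterval × unitInterval → S) : Prop :=
  Continuous ρ ∧ Function.Injective ρ ∧
    (∀ t, ∃ x, ∀ s, ρ (s, t) ∈ L x) ∧ (∀ s, ∃ x, ∀ t, ρ (s, t) ∈ L' x)

/-- The vertical leaf of abscissa `s` of a parametrized rectangle. -/
def verticalLeaf (ρ : unitInterval × unitInterval → S) (s : unitInterval) : Set S :=
  range fun t => ρ (s, t)

/-- The extreme rails of a graph `δ` whose arcs lie in leaves of `L`: arcs `J` in leaves of `L'`
with at least one endpoint outside the regular part of `δ`, and which are a vertical side (the one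
at `s = 0`, without loss of generality) of an embedded rectangle whose horizontal sides are
contained in `⋃ δ` and all of whose other vertical leaves are regular rails. -/
def extremeRails (L L' : S → Set S) (δ : Set (Set S)) : Set (Set S) :=
  {J | (∃ a ∈ arcEndpoints J, a ∉ regularPart δ) ∧
    ∃ ρ, IsEmbeddedRectangle L L' ρ ∧ (∀ s, ρ (s, 0) ∈ ⋃₀ δ ∧ ρ (s, 1) ∈ ⋃₀ δ) ∧
      J = verticalLeaf ρ 0 ∧ ∀ s, s ≠ 0 → verticalLeaf ρ s ∈ regularRails L' δ}

/-- Elementary equivalence of rails: `J` and `J'` are vertical leaves of an embedded rectangle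
whose horizontal sides are contained in `⋃ δ` and whose vertical leaves are all regular rails. -/
def RailStep (L L' : S → Set S) (δ : Set (Set S)) (J J' : Set S) : Prop :=
  ∃ ρ, IsEmbeddedRectangle L L' ρ ∧ (∀ s, ρ (s, 0) ∈ ⋃₀ δ ∧ ρ (s, 1) ∈ ⋃₀ δ) ∧
    (∀ s, verticalLeaf ρ s ∈ regularRails L' δ) ∧
    (∃ s, J = verticalLeaf ρ s) ∧ (∃ s, J' = verticalLeaf ρ s)

/-- The classes of regular rails for the equivalence relation generated by `RailStep`. -/
def railClasses (L L' : S → Set S) (δ : Set (Set S)) : Set (Set (Set S)) :=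
  {r | ∃ J ∈ regularRails L' δ, r = {J' | Relation.EqvGen (RailStep L L' δ) J J'}}

/-- Compatibility of an `s`-graph `δs` (arcs in leaves of `Ls`) and a `u`-graph `δu` (arcs in leaves
of `Lu`). -/
def Compatible (Ls Lu : S → Set S) (δs δu : Set (Set S)) : Prop :=
  graphEndpoints δs ⊆ ⋃₀ δu ∧ graphEndpoints δu ⊆ ⋃₀ δs ∧
    (∀ J ∈ extremeRails Ls Lu δs, J ⊆ ⋃₀ δu) ∧ (∀ I ∈ extremeRails Lu Ls δu, I ⊆ ⋃₀ δs)

/-- The leaf of `r` through `x`: the connected component containing `x` of the trace on `r` of the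
leaf of `x`. -/
def traceLeaf (L : S → Set S) (r : Set S) (x : S) : Set S := connectedComponentIn (L x ∩ r) x

/-- Trivially bi-foliated open sets.  Their closures are the rectangles. -/
def TriviallyBifoliated (Ls Lu : S → Set S) (r : Set S) : Prop :=
  IsOpen r ∧ IsConnected r ∧
    (∀ x ∈ r, ∃ a b, IsArc (closure (traceLeaf Ls r x)) a b) ∧
    (∀ x ∈ r, ∃ a b, IsArc (closure (traceLeaf Lu r x)) a b) ∧
    ∀ x ∈ r, ∀ y ∈ r, ∃ w ∈ r, closure (traceLeaf Ls r x) ∩ closure (traceLeaf Lu r y) = {w}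

/-- `c` is the interior of a sub-rectangle of the rectangle with interior `r`, and this
sub-rectangle stretches across the whole rectangle along `L`: it is a horizontal sub-rectangle if
`L` is the stable foliation, and a vertical one if `L` is the unstable foliation. -/
def IsSubrectangle (Ls Lu L : S → Set S) (c r : Set S) : Prop :=
  TriviallyBifoliated Ls Lu c ∧ c ⊆ r ∧ ∀ x ∈ c, traceLeaf L c x = traceLeaf L r x

/-- The image of a family of sets under a map. -/
def imageFamily {T : Type*} (h : S → T) (δ : Set (Set S)) : Set (Set T) := (fun A => h '' A) '' δ

end Arcs

/-! ### First intersection points and primitive Markov partitions -/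

namespace PseudoAnosov

variable {S : Type*} [TopologicalSpace S] (F : PseudoAnosov S)

/-- `𝓡` is a Markov partition; `int R` is the interior of the rectangle `R`. -/
def IsMarkovPartition (𝓡 : Set (Set S)) : Prop :=
  𝓡.Finite ∧ ⋃₀ 𝓡 = univ ∧ ∃ int : Set S → Set S,
    (∀ R ∈ 𝓡, TriviallyBifoliated F.stableLeaf F.unstableLeaf (int R) ∧ closure (int R) = R) ∧
    (∀ R ∈ 𝓡, ∀ R' ∈ 𝓡, R ≠ R' → Disjoint (int R) (int R')) ∧
    (∀ R ∈ 𝓡, ∀ R' ∈ 𝓡, ∀ x ∈ int R ∩ F.map ⁻¹' int R',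
      IsSubrectangle F.stableLeaf F.unstableLeaf F.stableLeaf
        (connectedComponentIn (int R ∩ F.map ⁻¹' int R') x) (int R)) ∧
    (∀ R ∈ 𝓡, ∀ R' ∈ 𝓡, ∀ x ∈ F.map '' int R ∩ int R',
      IsSubrectangle F.stableLeaf F.unstableLeaf F.unstableLeaf
        (connectedComponentIn (F.map '' int R ∩ int R') x) (int R'))

/-- First intersection points: `A = [p, z]ˢ`, `B = [q, z]ᵘ` with `(p, z]ˢ ∩ (q, z]ᵘ = {z}`. -/
def IsFirstIntersection (z : S) : Prop :=
  z ∉ F.sing ∧ ∃ p ∈ F.sing, ∃ q ∈ F.sing, ∃ A B,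
    IsLeafArc F.stableLeaf A p z ∧ IsLeafArc F.unstableLeaf B q z ∧ (A \ {p}) ∩ (B \ {q}) = {z}

/-- The primitive segment `Jᵘ(z) = [q, z]ᵘ`.  An unstable leaf contains at most one
singular point and no closed curve, so that there is at most one arc in this union. -/
def primitiveSegment (z : S) : Set S :=
  ⋃₀ {B | ∃ q ∈ F.sing, IsLeafArc F.unstableLeaf B q z}

/-- `𝒥ᵘ(z) = ⋃ i, f⁻ⁱ(Jᵘ(z))`. -/
def primitiveUnion (z : S) : Set S := ⋃ i : ℕ, F.map.symm^[i] '' F.primitiveSegment z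

/-- The `s`-graph `δˢ(z)`, generated by `𝒥ᵘ(z)`. -/
def sGraph (z : S) : Set (Set S) := generatedGraph F.stableLeaf F.sing (F.primitiveUnion z)

/-- The `u`-graph `δᵘ(z)`, generated by `δˢ(z)`. -/
def uGraph (z : S) : Set (Set S) := generatedGraph F.unstableLeaf F.sing (⋃₀ F.sGraph z)

/-- The `u`-graph `fⁿ(δᵘ(z))`. -/
def uGraphIter (z : S) (n : ℕ) : Set (Set S) := imageFamily F.map^[n] (F.uGraph z)

/-- `δˢ(z)` and `fⁿ(δᵘ(z))` are compatible. -/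
def CompatibleAt (z : S) (n : ℕ) : Prop :=
  Compatible F.stableLeaf F.unstableLeaf (F.sGraph z) (F.uGraphIter z n)

/-- `N` is the compatibility coefficient `n(z)`: the least `N` such that `δˢ(z)` and `fⁿ(δᵘ(z))`
are compatible for all `n ≥ N`. -/
def IsCompatCoeff (z : S) (N : ℕ) : Prop := IsLeast {N | ∀ n ≥ N, F.CompatibleAt z n} N

/-- The family `ℛ(z, n)`, with stable boundary `⋃ δˢ(z)` and unstable boundary `⋃ fⁿ(δᵘ(z))`: the
closures of the connected components of the complement of the union of these two sets. -/
def partition (z : S) (n : ℕ) : Set (Set S) :=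
  {R | ∃ x ∈ (⋃₀ F.sGraph z ∪ ⋃₀ F.uGraphIter z n)ᶜ,
    R = closure (connectedComponentIn (⋃₀ F.sGraph z ∪ ⋃₀ F.uGraphIter z n)ᶜ x)}

/-- `𝓡` is the primitive Markov partition of order `n` generated by `z`. -/
def IsPrimitiveMarkovPartition (z : S) (n : ℕ) (𝓡 : Set (Set S)) : Prop :=
  F.IsFirstIntersection z ∧ (∃ N ≤ n, F.IsCompatCoeff z N) ∧ 𝓡 = F.partition z n ∧
    F.IsMarkovPartition 𝓡

end PseudoAnosov

/-! Everything in the statement is built from the topology, the dynamics, the stable and unstable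
leaves and the set of singular points. The conjugacy `h` visibly respects the first two; nothing is
assumed about its effect on the foliations. The substance is that the leaves and the prong numbers
are determined by the topological dynamics.

Stable arcs are recognised by contraction. Along a path of regular points the natural coordinate
lifts to a function `w`, unique up to sign and translation if the path is injective, and the `n`-th
iterate of the map multiplies differences of `Re w` by `λ⁻ⁿ` and those of `Im w` by `λⁿ`. A radial
arc in a stable plaque has real `w`, so its iterates become small (`shrinks_of_naturalLift`).
Conversely, if the iterates of an injective path in a chart become small, then `Im w` is constant;
if the path ends at the centre `q`, this forces it into the stable plaque of `q`
(`mem_stablePlaque_of_shrinks`). Shrinking is expressed by open covers and is invariant under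
conjugacy, so `h` maps stable plaques to stable plaques locally, and stable leaves onto stable
leaves. The inverse maps, with the foliations exchanged (`PseudoAnosov.dual`), give the unstable
leaves.

Locally `h` therefore embeds the star of stable prongs at `p` into the star at `h p`, so prong
numbers agree (`prong_le_of_injOn`) and singularities correspond. The remaining assertions are
formal transport along a homeomorphism that respects both families of leaves and the singular sets.
-/

/-! ### Natural lifts of paths -/

namespace MeasuredFoliations

variable {S : Type*} [TopologicalSpace S] (𝓕 : MeasuredFoliations S)

/-- `w` is the natural coordinate along the path `γ` of regular points: near each parameter in `I`
it agrees, up to sign and translation, with the natural chart. -/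
def NaturalLift (γ : ℝ → S) (w : ℝ → ℂ) (I : Set ℝ) : Prop :=
  ∀ t ∈ I, 𝓕.prong (γ t) = 2 ∧ ∃ ε : ℝ, (ε = 1 ∨ ε = -1) ∧
    ∀ᶠ s in 𝓝[I] t, w s - w t = ε * 𝓕.chart (γ t) (γ s)

theorem prong_ne_zero (p : S) : 𝓕.prong p ≠ 0 := (Nat.lt_of_lt_of_le Nat.zero_lt_one (𝓕.prong_pos p)).ne'

theorem chart_eq_zero_iff {p x : S} (hx : x ∈ (𝓕.chart p).source) :
    𝓕.chart p x = 0 ↔ x = p := by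
  constructor
  · intro h
    exact (𝓕.chart p).injOn hx (𝓕.mem_source p) (h.trans (𝓕.chart_self p).symm)
  · rintro rfl
    exact 𝓕.chart_self x

/-- A continuous square root of `(chart p) ^ (prong p)` along a path that avoids `p` is a natural
lift. -/
theorem naturalLift_of_sq_eq {γ : ℝ → S} (hγ : Continuous γ) {w : ℝ → ℂ} {I : Set ℝ}
    (hw : ContinuousOn w I) (p : S) (hsrc : ∀ t ∈ I, γ t ∈ (𝓕.chart p).source)
    (hsq : ∀ t ∈ I, w t ^ 2 = 𝓕.chart p (γ t) ^ 𝓕.prong p)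
    (t : ℝ) (ht : t ∈ I) (hne : γ t ≠ p) :
    𝓕.prong (γ t) = 2 ∧ ∃ ε : ℝ, (ε = 1 ∨ ε = -1) ∧
      ∀ᶠ s in 𝓝[I] t, w s - w t = ε * 𝓕.chart (γ t) (γ s) := by
  obtain ⟨h2, c, hc⟩ := 𝓕.compatible p (γ t) (hsrc t ht) hne
  refine ⟨h2, ?_⟩
  have hct : c ^ 2 = w t ^ 2 := by
    rw [hsq t ht, ← hc.self_of_nhds, 𝓕.chart_self]; ring
  have hwt : w t ≠ 0 := by
    intro h0
    have := hsq t ht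
    rw [h0, zero_pow two_ne_zero, eq_comm, pow_eq_zero_iff (𝓕.prong_ne_zero p),
      𝓕.chart_eq_zero_iff (hsrc t ht)] at this
    exact hne this
  -- With this sign `w t = ε * (0 - c)`. Writing `χ` for the chart at `γ t`, the factor `w + ε (χ -
  -- c)` of `w ^ 2 - (χ - c) ^ 2` tends to `2 * w t ≠ 0`, so the other factor vanishes near `t`.
  obtain ⟨ε, hε, hεc⟩ : ∃ ε : ℝ, (ε = 1 ∨ ε = -1) ∧ w t = -ε * c := by
    rcases sq_eq_sq_iff_eq_or_eq_neg.1 hct with h | h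
    · exact ⟨-1, Or.inr rfl, by rw [h]; push_cast; ring⟩
    · exact ⟨1, Or.inl rfl, by rw [h]; push_cast; ring⟩
  have hε2 : (ε : ℂ) ^ 2 = 1 := by rcases hε with rfl | rfl <;> norm_num
  refine ⟨ε, hε, ?_⟩
  have hcγ : Tendsto γ (𝓝[I] t) (𝓝 (γ t)) := hγ.continuousWithinAt
  have hchart : Tendsto (fun s => 𝓕.chart (γ t) (γ s)) (𝓝[I] t) (𝓝 0) := by
    have := ((𝓕.chart (γ t)).continuousAt (𝓕.mem_source (γ t))).tendsto.comp hcγ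
    rwa [𝓕.chart_self] at this
  have hlim : Tendsto (fun s => w s + ε * (𝓕.chart (γ t) (γ s) - c)) (𝓝[I] t)
      (𝓝 (w t + ε * (0 - c))) :=
    (hw t ht).tendsto.add ((hchart.sub_const c).const_mul _)
  have hne0 : w t + ε * (0 - c) ≠ 0 := by
    have : w t + ε * (0 - c) = 2 * w t := by rw [hεc]; ring
    rw [this]; exact mul_ne_zero two_ne_zero hwt
  filter_upwards [hlim.eventually_ne hne0, hcγ.eventually hc, self_mem_nhdsWithin]
    with s hs1 hs2 hs3
  have h0 : (w s + ε * (𝓕.chart (γ t) (γ s) - c)) * (w s - ε * (𝓕.chart (γ t) (γ s) - c)) = 0 := by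
    have := hsq s hs3
    rw [← hs2] at this
    linear_combination this - (𝓕.chart (γ t) (γ s) - c) ^ 2 * hε2
  have h1 := (mul_eq_zero.1 h0).resolve_left hs1
  linear_combination h1 - hεc

/-- At a regular centre no square root has to be chosen, and the path may pass through `p`; that
point is outside the scope of `compatible` and is treated directly. -/
theorem naturalLift_chart {γ : ℝ → S} (hγ : Continuous γ) {I : Set ℝ} (p : S)
    (hp : 𝓕.prong p = 2) (hsrc : ∀ t ∈ I, γ t ∈ (𝓕.chart p).source) :
    𝓕.NaturalLift γ (fun t => 𝓕.chart p (γ t)) I := by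
  intro t ht
  by_cases hne : γ t = p
  · refine ⟨by rw [hne, hp], 1, Or.inl rfl, Eventually.of_forall fun s => ?_⟩
    simp [hne, 𝓕.chart_self]
  · refine 𝓕.naturalLift_of_sq_eq hγ ?_ p hsrc ?_ t ht hne
    · exact (𝓕.chart p).continuousOn.comp hγ.continuousOn hsrc
    · intro t _
      rw [hp]

/-- Along a path of regular points in the domain of a chart there is a natural lift that is a square
root of `(chart p) ^ (prong p)`. -/
theorem exists_naturalLift {γ : ℝ → S} (hγ : Continuous γ) (p : S)
    (hsrc : ∀ t ∈ Ioo (0 : ℝ) 1, γ t ∈ (𝓕.chart p).source)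
    (h : 𝓕.prong p = 2 ∨ ∀ t ∈ Ioo (0 : ℝ) 1, γ t ≠ p) :
    ∃ w : ℝ → ℂ, 𝓕.NaturalLift γ w (Ioo 0 1) ∧
      ∀ t ∈ Ioo (0 : ℝ) 1, w t ^ 2 = 𝓕.chart p (γ t) ^ 𝓕.prong p := by
  rcases h with hp | hne
  · exact ⟨_, 𝓕.naturalLift_chart hγ p hp hsrc, fun t _ => by rw [hp]⟩
  -- Off the centre the function has no zero, and a nowhere zero continuous function on a simply
  -- connected set has a continuous square root.
  · have hU : IsSimplyConnected (Ioo (0 : ℝ) 1) := by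
      have : ContractibleSpace (Ioo (0 : ℝ) 1) :=
        (convex_Ioo (0 : ℝ) 1).contractibleSpace (by simp)
      have : SimplyConnectedSpace (Ioo (0 : ℝ) 1) := inferInstance
      exact this
    obtain ⟨w, hw, hw2⟩ := Complex.exists_continuousOn_pow_eq hU isOpen_Ioo
      (g := fun t => 𝓕.chart p (γ t) ^ 𝓕.prong p)
      (((𝓕.chart p).continuousOn.comp hγ.continuousOn hsrc).pow _)
      (by
        rintro ⟨t, ht, h0⟩
        rw [pow_eq_zero_iff (𝓕.prong_ne_zero p), 𝓕.chart_eq_zero_iff (hsrc t ht)] at h0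
        exact hne t ht h0) two_ne_zero
    exact ⟨w, fun t ht => 𝓕.naturalLift_of_sq_eq hγ hw p hsrc (fun t _ => hw2 t) t ht (hne t ht),
      fun t _ => hw2 t⟩

/-- Natural lifts of an injective path are unique up to sign and translation. -/
theorem NaturalLift.unique {γ : ℝ → S} (hγ : Continuous γ) {I : Set ℝ} (hI : IsOpen I)
    (hIc : IsPreconnected I) (hinj : InjOn γ I) {w w' : ℝ → ℂ} (hw : 𝓕.NaturalLift γ w I)
    (hw' : 𝓕.NaturalLift γ w' I) {a b : ℝ} (ha : a ∈ I) (hb : b ∈ I) :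
    ∃ ε : ℝ, (ε = 1 ∨ ε = -1) ∧ w' b - w' a = ε * (w b - w a) := by
  have hloc : ∀ t ∈ I, ∃ ε : ℝ, (ε = 1 ∨ ε = -1) ∧
      ∀ᶠ s in 𝓝 t, w' s - w' t = ε * (w s - w t) := by
    intro t ht
    obtain ⟨-, ε, hε, h⟩ := hw t ht
    obtain ⟨-, ε', hε', h'⟩ := hw' t ht
    rw [hI.nhdsWithin_eq ht] at h h'
    refine ⟨ε' * ε, by rcases hε with rfl | rfl <;> rcases hε' with rfl | rfl <;> norm_num, ?_⟩
    have hε2 : (ε : ℂ) ^ 2 = 1 := by rcases hε with rfl | rfl <;> norm_num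
    filter_upwards [h, h'] with s h1 h2
    rw [h1, h2]; push_cast
    linear_combination -(ε' * 𝓕.chart (γ t) (γ s)) * hε2
  -- Injectivity of the path keeps `w` from being constant near `t`, so that the local sign is
  -- unique.
  have hne : ∀ t ∈ I, ∀ᶠ s in 𝓝[≠] t, w s ≠ w t := by
    intro t ht
    obtain ⟨-, ε, hε, h⟩ := hw t ht
    rw [hI.nhdsWithin_eq ht] at h
    have hs : ∀ᶠ s in 𝓝 t, γ s ∈ (𝓕.chart (γ t)).source :=
      hγ.continuousAt ((𝓕.chart (γ t)).open_source.mem_nhds (𝓕.mem_source _))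
    filter_upwards [h.filter_mono nhdsWithin_le_nhds, hs.filter_mono nhdsWithin_le_nhds,
      self_mem_nhdsWithin, mem_nhdsWithin_of_mem_nhds (hI.mem_nhds ht)]
      with s h1 h2 h3 h4 h5
    rw [h5, sub_self, eq_comm, mul_eq_zero] at h1
    rcases h1 with h1 | h1
    · rcases hε with rfl | rfl <;> norm_num at h1
    · rw [𝓕.chart_eq_zero_iff h2] at h1
      exact h3 (hinj h4 ht h1)
  have huniq : ∀ t ∈ I, ∀ ε₁ ε₂ : ℝ, (∀ᶠ s in 𝓝 t, w' s - w' t = ε₁ * (w s - w t)) →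
      (∀ᶠ s in 𝓝 t, w' s - w' t = ε₂ * (w s - w t)) → ε₁ = ε₂ := by
    intro t ht ε₁ ε₂ h1 h2
    obtain ⟨s, hs1, hs2, hs3⟩ := ((h1.filter_mono nhdsWithin_le_nhds).and
      ((h2.filter_mono nhdsWithin_le_nhds).and (hne t ht))).exists
    have := mul_right_cancel₀ (sub_ne_zero.2 hs3) (hs1.symm.trans hs2)
    exact_mod_cast this
  -- The relation records that one sign serves near `x`, near `y` and for the increment between
  -- them; this makes it transitive, and connectedness spreads it over `I`.
  have key := hIc.induction₂ (fun x y => ∃ ε : ℝ, (ε = 1 ∨ ε = -1) ∧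
      (∀ᶠ s in 𝓝 x, w' s - w' x = ε * (w s - w x)) ∧
      (∀ᶠ s in 𝓝 y, w' s - w' y = ε * (w s - w y)) ∧ w' y - w' x = ε * (w y - w x))
    (by
      intro t ht
      obtain ⟨ε, hε, h⟩ := hloc t ht
      rw [hI.nhdsWithin_eq ht]
      filter_upwards [h, h.eventually_nhds] with y hy hy'
      refine ⟨ε, hε, h, ?_, hy⟩
      filter_upwards [hy'] with s hs
      linear_combination hs - hy)
    (by
      rintro x y z hx hy hz ⟨ε, hε, h1, h2, h3⟩ ⟨ε', hε', h1', h2', h3'⟩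
      obtain rfl := huniq y hy _ _ h2 h1'
      exact ⟨ε, hε, h1, h2', by linear_combination h3 + h3'⟩)
    (by
      rintro x y hx hy ⟨ε, hε, h1, h2, h3⟩
      exact ⟨ε, hε, h2, h1, by linear_combination -h3⟩) ha hb
  obtain ⟨ε, hε, -, -, h⟩ := key
  exact ⟨ε, hε, h⟩

end MeasuredFoliations

/-- The linear map that contracts the real axis by `l⁻¹` and stretches the imaginary axis by `l`. -/
noncomputable def hyperbolicMap (l : ℝ) (z : ℂ) : ℂ := ⟨l⁻¹ * z.re, l * z.im⟩

/-- The hyperbolic linear map commutes with signs, so the sign in `expands` is absorbed by the sign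
ambiguity of lifts. -/
theorem MeasuredFoliations.NaturalLift.map {S : Type*} [TopologicalSpace S] (F : PseudoAnosov S)
    {γ : ℝ → S} (hγ : Continuous γ) {w : ℝ → ℂ} {I : Set ℝ}
    (h : F.NaturalLift γ w I) :
    F.NaturalLift (fun t => F.map (γ t)) (fun t => hyperbolicMap F.lam (w t)) I := by
  intro t ht
  obtain ⟨h2, ε, hε, h⟩ := h t ht
  obtain ⟨ε', hε', h'⟩ := F.expands (γ t) h2
  refine ⟨by rw [F.prong_map, h2], ε * ε',
    by rcases hε with rfl | rfl <;> rcases hε' with rfl | rfl <;> norm_num, ?_⟩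
  have hcγ : Tendsto γ (𝓝[I] t) (𝓝 (γ t)) := hγ.continuousWithinAt
  have hε2 : ε' * ε' = 1 := by rcases hε' with rfl | rfl <;> norm_num
  filter_upwards [h, hcγ.eventually h'] with s h1 h2
  rw [h2]
  have hre := congrArg Complex.re h1
  have him := congrArg Complex.im h1
  simp only [Complex.sub_re, Complex.sub_im, Complex.re_ofReal_mul, Complex.im_ofReal_mul] at hre him
  apply Complex.ext
  · rw [Complex.re_ofReal_mul]
    simp only [hyperbolicMap, Complex.sub_re]
    linear_combination F.lam⁻¹ * hre - ε * F.lam⁻¹ * (F.chart (γ t) (γ s)).re * hε2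
  · rw [Complex.im_ofReal_mul]
    simp only [hyperbolicMap, Complex.sub_im]
    linear_combination F.lam * him - ε * F.lam * (F.chart (γ t) (γ s)).im * hε2

/-- An iterated path need not fit in a single chart, yet one formula still gives its lift; this is
the reason for working with lifts instead of charts. -/
theorem MeasuredFoliations.NaturalLift.iterate {S : Type*} [TopologicalSpace S]
    (F : PseudoAnosov S) {γ : ℝ → S} (hγ : Continuous γ) {w : ℝ → ℂ} {I : Set ℝ}
    (h : F.NaturalLift γ w I) (n : ℕ) :
    F.NaturalLift (fun t => F.map^[n] (γ t)) (fun t => hyperbolicMap (F.lam ^ n) (w t)) I := by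
  induction n with
  | zero => simpa [hyperbolicMap] using h
  | succ n ih =>
    have := ih.map F ((F.map.continuous.iterate n).comp hγ)
    simp only [Function.iterate_succ_apply']
    have heq : (fun t => hyperbolicMap (F.lam ^ (n + 1)) (w t)) =
        fun t => hyperbolicMap F.lam (hyperbolicMap (F.lam ^ n) (w t)) := by
      funext t
      apply Complex.ext <;> simp [hyperbolicMap, pow_succ] <;> ring
    rw [heq]
    exact this

/-! ### Shrinking sets -/

/-- The iterates of `C` become arbitrarily small. -/
def Shrinks {S : Type*} [TopologicalSpace S] (f : S → S) (C : Set S) : Prop :=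
  ∀ 𝒰 : Set (Set S), (∀ U ∈ 𝒰, IsOpen U) → ⋃₀ 𝒰 = univ → ∀ᶠ n in atTop, ∃ U ∈ 𝒰, f^[n] '' C ⊆ U

/-- Open covers replace a metric here, and a cover of `T` pulls back along `h` to a cover of `S`. -/
theorem Shrinks.image {S T : Type*} [TopologicalSpace S] [TopologicalSpace T] {f : S → S}
    {g : T → T} {C : Set S} (hC : Shrinks f C) (h : S ≃ₜ T) (hfg : ∀ x, h (f x) = g (h x)) :
    Shrinks g (h '' C) := by
  intro 𝒰 hopen hcov
  have hconj : ∀ n x, h (f^[n] x) = g^[n] (h x) := fun n x =>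
    (Function.Semiconj.iterate_right (f := h) hfg n) x
  filter_upwards [hC ((fun U => h ⁻¹' U) '' 𝒰)
    (by rintro _ ⟨U, hU, rfl⟩; exact (hopen U hU).preimage h.continuous)
    (by
      refine eq_univ_of_forall fun x => ?_
      obtain ⟨U, hU, hx⟩ := mem_sUnion.1 (hcov ▸ mem_univ (h x))
      exact ⟨_, ⟨U, hU, rfl⟩, hx⟩)] with n hn
  obtain ⟨_, ⟨U, hU, rfl⟩, hsub⟩ := hn
  refine ⟨U, hU, ?_⟩
  rintro _ ⟨_, ⟨x, hx, rfl⟩, rfl⟩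
  rw [← hconj]
  exact hsub ⟨x, hx, rfl⟩

/-- An injective path that ends at `q`, stays in the natural chart at `q` and shrinks under the
iterates of a pseudo-Anosov map starts in the stable plaque of `q`. -/
theorem PseudoAnosov.mem_stablePlaque_of_shrinks {T : Type*} [TopologicalSpace T]
    (G : PseudoAnosov T) (q : T) {γ : ℝ → T} (hγ : Continuous γ) (hinj : InjOn γ (Icc 0 1))
    (hq : γ 1 = q) (hsrc : ∀ t ∈ Icc (0 : ℝ) 1, γ t ∈ (G.chart q).source)
    (hsh : Shrinks G.map (γ '' Icc 0 1)) : γ 0 ∈ G.stablePlaque q := by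
  have hsub : Ioo (0 : ℝ) 1 ⊆ Icc 0 1 := Ioo_subset_Icc_self
  have hinj' : InjOn γ (Ioo 0 1) := hinj.mono hsub
  obtain ⟨w, hw, hw2⟩ := G.exists_naturalLift hγ q (fun t ht => hsrc t (hsub ht)) (Or.inr (by
    intro t ht h
    exact ht.2.ne (hinj (hsub ht) (by simp) (h.trans hq.symm))))
  -- Once the `n`-th iterate of the path lies in a unit ball of some chart, its imaginary variation
  -- is at most `2`; but this variation is `λⁿ` times the original one, which must therefore be
  -- zero.
  have hconst : ∀ a ∈ Ioo (0 : ℝ) 1, ∀ b ∈ Ioo (0 : ℝ) 1, (w b).im = (w a).im := by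
    intro a ha b hb
    have hev := hsh (range fun p => (G.chart p).source ∩ G.chart p ⁻¹' Metric.ball 0 1)
      (by
        rintro _ ⟨p, rfl⟩
        exact (G.chart p).isOpen_inter_preimage Metric.isOpen_ball)
      (eq_univ_of_forall fun p => ⟨_, ⟨p, rfl⟩, G.mem_source p, by simp [G.chart_self]⟩)
    have hbound : ∀ᶠ n in atTop, G.lam ^ n * |(w b).im - (w a).im| ≤ 2 := by
      filter_upwards [hev] with n hn
      obtain ⟨_, ⟨p, rfl⟩, hsubn⟩ := hn
      have hmem : ∀ t ∈ Ioo (0 : ℝ) 1, G.map^[n] (γ t) ∈ (G.chart p).source ∧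
          ‖G.chart p (G.map^[n] (γ t))‖ < 1 := by
        intro t ht
        have := hsubn ⟨γ t, ⟨t, hsub ht, rfl⟩, rfl⟩
        simpa using this
      have hlift := hw.iterate G hγ n
      have hcont : Continuous fun t => G.map^[n] (γ t) := (G.map.continuous.iterate n).comp hγ
      have hinjn : InjOn (fun t => G.map^[n] (γ t)) (Ioo 0 1) := fun x hx y hy h =>
        hinj' hx hy (G.map.injective.iterate n h)
      -- The centre `p` of that chart is arbitrary. If it is singular the path avoids it, since
      -- iterates of regular points are regular.
      obtain ⟨v, hv, hv2⟩ := G.exists_naturalLift hcont p (fun t ht => (hmem t ht).1) (by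
        by_cases hp : G.prong p = 2
        · exact Or.inl hp
        · refine Or.inr fun t ht h => hp ?_
          rw [← h]
          exact (hlift t ht).1)
      obtain ⟨ε, hε, heq⟩ := MeasuredFoliations.NaturalLift.unique _ hcont isOpen_Ioo
        isPreconnected_Ioo hinjn hlift hv ha hb
      have hvle : ∀ t ∈ Ioo (0 : ℝ) 1, ‖v t‖ ≤ 1 := by
        intro t ht
        have h1 : ‖v t‖ ^ 2 ≤ 1 := by
          rw [← norm_pow, hv2 t ht, norm_pow]
          exact pow_le_one₀ (norm_nonneg _) (hmem t ht).2.le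
        exact (sq_le_one_iff₀ (norm_nonneg _)).1 h1
      have him := congrArg Complex.im heq
      rw [Complex.im_ofReal_mul] at him
      simp only [hyperbolicMap, Complex.sub_im] at him
      have hpow : 0 < G.lam ^ n := pow_pos (zero_lt_one.trans G.one_lt_lam) n
      calc G.lam ^ n * |(w b).im - (w a).im| = |(v b).im - (v a).im| := by
            rw [him, ← mul_sub, abs_mul, abs_mul, abs_of_pos hpow]
            rcases hε with rfl | rfl <;> simp
        _ ≤ |(v b).im| + |(v a).im| := abs_sub _ _
        _ ≤ ‖v b‖ + ‖v a‖ := add_le_add (Complex.abs_im_le_norm _) (Complex.abs_im_le_norm _)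
        _ ≤ 2 := by linarith [hvle a ha, hvle b hb]
    by_contra hne
    have hpos : 0 < |(w b).im - (w a).im| := abs_pos.2 (sub_ne_zero.2 hne)
    have htop := (tendsto_pow_atTop_atTop_of_one_lt G.one_lt_lam).atTop_mul_const hpos
    obtain ⟨n, h1, h2⟩ := (hbound.and (htop.eventually_gt_atTop 2)).exists
    linarith
  -- `m` recovers `(Im w) ^ 2` from `w ^ 2`, hence from the chart itself. It extends the constancy
  -- of `(Im w) ^ 2` to the endpoints, where no lift is available; the value is `0` at `q`, hence at
  -- the starting point.
  set m : ℂ → ℝ := fun W => (‖W‖ - W.re) / 2 with hm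
  have hmcont : Continuous m := by fun_prop
  have hmsq : ∀ z : ℂ, m (z ^ 2) = z.im ^ 2 := by
    intro z
    have h1 : ‖z‖ ^ 2 = z.re ^ 2 + z.im ^ 2 := by
      rw [← Complex.normSq_eq_norm_sq, Complex.normSq_apply]; ring
    simp only [hm, norm_pow, h1]
    simp [pow_two]
  set μ : ℝ → ℝ := fun t => m (G.chart q (γ t) ^ G.prong q) with hμ
  have hμcont : ContinuousOn μ (Icc 0 1) :=
    hmcont.comp_continuousOn (((G.chart q).continuousOn.comp hγ.continuousOn hsrc).pow _)
  have hμeq : ∀ t ∈ Ioo (0 : ℝ) 1, μ t = (w (1 / 2)).im ^ 2 := by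
    intro t ht
    simp only [hμ]
    rw [← hw2 t ht, hmsq, hconst (1 / 2) (by norm_num) t ht]
  have hclos : ∀ t ∈ Icc (0 : ℝ) 1, μ t = (w (1 / 2)).im ^ 2 := by
    have : EqOn μ (fun _ => (w (1 / 2)).im ^ 2) (Icc 0 1) :=
      EqOn.of_subset_closure hμeq hμcont continuousOn_const hsub (by rw [closure_Ioo]; norm_num)
    exact this
  have hμ1 : μ 1 = 0 := by
    simp [hμ, hm, hq, G.chart_self, G.prong_ne_zero q]
  have hμ0 : μ 0 = 0 := by
    rw [hclos 0 (by simp), ← hclos 1 (by simp), hμ1]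
  refine ⟨hsrc 0 (by simp), ‖G.chart q (γ 0) ^ G.prong q‖, norm_nonneg _, ?_⟩
  have hre : ‖G.chart q (γ 0) ^ G.prong q‖ = (G.chart q (γ 0) ^ G.prong q).re := by
    simp only [hμ, hm] at hμ0
    linarith
  have := Complex.re_eq_norm.1 hre.symm
  rw [hre]
  exact Complex.eq_re_of_ofReal_le (r := 0) (by simpa using this)

/-! ### Short paths in natural coordinates and radial arcs in stable plaques -/

namespace MeasuredFoliations

variable {S : Type*} [TopologicalSpace S] (𝓕 : MeasuredFoliations S)

/-- Short leaf arcs are small: given an open cover, every path whose natural speed is small enough is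
contained in a member of the cover.  Nothing is required of the speed at the final point. -/
theorem exists_forall_speed_lt [T2Space S] [CompactSpace S] (𝒰 : Set (Set S))
    (hopen : ∀ U ∈ 𝒰, IsOpen U) (hcov : ⋃₀ 𝒰 = univ) :
    ∃ δ > 0, ∀ (σ : ℝ → S) (l : ℝ), Continuous σ → 0 ≤ l → l < δ →
      (∀ t ∈ Ico (0 : ℝ) 1, 𝓕.prong (σ t) = 2 ∧
        ∀ᶠ s in 𝓝[Ico 0 1] t, ‖𝓕.chart (σ t) (σ s)‖ ≤ l * |s - t|) →
      ∃ U ∈ 𝒰, σ '' Icc 0 1 ⊆ U := by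
  suffices h : ∃ δ > 0, ∀ (σ : ℝ → S) (l : ℝ), σ 0 ∈ (univ : Set S) → Continuous σ → 0 ≤ l →
      l < δ → (∀ t ∈ Ico (0 : ℝ) 1, 𝓕.prong (σ t) = 2 ∧
        ∀ᶠ s in 𝓝[Ico 0 1] t, ‖𝓕.chart (σ t) (σ s)‖ ≤ l * |s - t|) →
      ∃ U ∈ 𝒰, σ '' Icc 0 1 ⊆ U by
    obtain ⟨δ, hδ, h⟩ := h
    exact ⟨δ, hδ, fun σ l => h σ l (mem_univ _)⟩
  -- By compactness it suffices to find a `δ` that serves all paths starting near a given point `q`.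
  refine isCompact_univ.induction_on (p := fun X => ∃ δ > 0, ∀ (σ : ℝ → S) (l : ℝ), σ 0 ∈ X →
      Continuous σ → 0 ≤ l → l < δ → (∀ t ∈ Ico (0 : ℝ) 1, 𝓕.prong (σ t) = 2 ∧
        ∀ᶠ s in 𝓝[Ico 0 1] t, ‖𝓕.chart (σ t) (σ s)‖ ≤ l * |s - t|) →
      ∃ U ∈ 𝒰, σ '' Icc 0 1 ⊆ U) ?_ ?_ ?_ ?_
  · exact ⟨1, one_pos, fun σ l h => absurd h (notMem_empty _)⟩
  · rintro X Y hXY ⟨δ, hδ, h⟩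
    exact ⟨δ, hδ, fun σ l hσ => h σ l (hXY hσ)⟩
  · rintro X Y ⟨δ, hδ, h⟩ ⟨δ', hδ', h'⟩
    refine ⟨min δ δ', lt_min hδ hδ', fun σ l hσ hc h0 hl hs => ?_⟩
    rcases hσ with hσ | hσ
    · exact h σ l hσ hc h0 (hl.trans_le (min_le_left _ _)) hs
    · exact h' σ l hσ hc h0 (hl.trans_le (min_le_right _ _)) hs
  intro q _
  obtain ⟨U, hU, hqU⟩ := mem_sUnion.1 (hcov ▸ mem_univ q)
  set φ := 𝓕.chart q with hφ
  set k := 𝓕.prong q with hk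
  have hk0 : k ≠ 0 := 𝓕.prong_ne_zero q
  have hopenφ : IsOpen (φ.target ∩ φ.symm ⁻¹' U) := φ.isOpen_inter_preimage_symm (hopen U hU)
  have hzero : (0 : ℂ) ∈ φ.target ∩ φ.symm ⁻¹' U := by
    have h0 : φ q = 0 := 𝓕.chart_self q
    refine ⟨h0 ▸ φ.map_source (𝓕.mem_source q), ?_⟩
    rw [mem_preimage, ← h0, φ.left_inv (𝓕.mem_source q)]
    exact hqU
  obtain ⟨ρ, hρ, hball⟩ := Metric.nhds_basis_closedBall.mem_iff.1 (hopenφ.mem_nhds hzero)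
  -- `K` is closed in `S` and lies in the chart domain, so a path that stays in `K` cannot escape
  -- from the chart in the limit.
  set K : Set S := φ.symm '' Metric.closedBall 0 ρ with hK
  have hKc : IsClosed K :=
    ((isCompact_closedBall 0 ρ).image_of_continuousOn
      (φ.symm.continuousOn.mono fun z hz => (hball hz).1)).isClosed
  have hKsrc : K ⊆ φ.source := by
    rintro _ ⟨z, hz, rfl⟩
    exact φ.map_target (hball hz).1
  have hKU : K ⊆ U := by
    rintro _ ⟨z, hz, rfl⟩
    exact (hball hz).2
  have hKmem : ∀ y ∈ φ.source, ‖φ y‖ ≤ ρ → y ∈ K := fun y hy hyρ =>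
    ⟨φ y, by simpa using hyρ, φ.left_inv hy⟩
  -- The modulus `|φ| ^ (k / 2)` of the natural coordinate centred at `q`. Along a path it grows no
  -- faster than the natural speed, also when `q` is singular.
  set N : S → ℝ := fun y => √(‖φ y‖ ^ k) with hN
  have hNcont : ContinuousOn N φ.source :=
    Real.continuous_sqrt.comp_continuousOn ((φ.continuousOn.norm).pow k)
  set R : ℝ := √(ρ ^ k) with hR
  have hRpos : 0 < R := Real.sqrt_pos.2 (pow_pos hρ k)
  have hNlt : ∀ y, N y < R → ‖φ y‖ < ρ := by
    intro y hy
    exact lt_of_pow_lt_pow_left₀ k hρ.le ((Real.sqrt_lt_sqrt_iff (by positivity)).1 hy)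
  have hNq : N q < R / 2 := by
    have : N q = 0 := by simp [hN, hφ, 𝓕.chart_self, hk0]
    rw [this]; positivity
  refine ⟨φ.source ∩ N ⁻¹' Iio (R / 2), ?_, R / 2, half_pos hRpos, ?_⟩
  · refine mem_nhdsWithin_of_mem_nhds (Filter.inter_mem (φ.open_source.mem_nhds (𝓕.mem_source q)) ?_)
    exact (hNcont.continuousAt (φ.open_source.mem_nhds (𝓕.mem_source q))) (Iio_mem_nhds hNq)
  rintro σ l ⟨hσ0, hσN⟩ hσ hl0 hl hs
  rw [mem_preimage, mem_Iio] at hσN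
  refine ⟨U, hU, ?_⟩
  -- Continuous induction on `t`: `N` starts below `R / 2` and gains at most `l < R / 2`, so it
  -- stays below `R` and the path stays in `K ⊆ U`.
  set A : Set ℝ := {t | σ t ∈ K ∧ N (σ t) ≤ N (σ 0) + l * t} with hA
  have hAclosed : IsClosed (A ∩ Icc 0 1) := by
    have h1 : IsClosed (σ ⁻¹' K) := hKc.preimage hσ
    have h2 : ContinuousOn (fun t => N (σ t)) (σ ⁻¹' K) :=
      hNcont.comp hσ.continuousOn fun t ht => hKsrc ht
    have h3 := h2.sub (f := fun t => N (σ t)) (g := fun t => N (σ 0) + l * t) (by fun_prop)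
    have h4 := h3.preimage_isClosed_of_isClosed h1 (isClosed_Iic (a := (0 : ℝ)))
    convert h4.inter isClosed_Icc using 2
    ext t
    simp [hA]
  have hA0 : (0 : ℝ) ∈ A := ⟨hKmem _ hσ0 (hNlt _ (by linarith)).le, by simp⟩
  have hsubA := hAclosed.Icc_subset_of_forall_mem_nhdsWithin hA0 (by
    rintro t ⟨⟨htK, htN⟩, ht⟩
    have htlt : N (σ t) < R := by
      have : l * t ≤ l := mul_le_of_le_one_right hl0 ht.2.le
      linarith
    have hsrc := hKsrc htK
    obtain ⟨h2, hsp⟩ := hs t ht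
    have hsp' : ∀ᶠ s in 𝓝[>] t, ‖𝓕.chart (σ t) (σ s)‖ ≤ l * |s - t| := by
      refine hsp.filter_mono ?_
      rw [← nhdsWithin_Ioo_eq_nhdsGT ht.2]
      exact nhdsWithin_mono _ fun s hs => ⟨ht.1.trans hs.1.le, hs.2⟩
    have hσt : Tendsto σ (𝓝[>] t) (𝓝 (σ t)) := hσ.continuousAt.continuousWithinAt
    have hNstep : ∀ᶠ s in 𝓝[>] t, N (σ s) ≤ N (σ t) + l * |s - t| := by
      -- The path consists of regular points at times before `1`, so it can be at `q` then only if
      -- `k = 2`.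
      by_cases hne : σ t = q
      · have hk2 : k = 2 := by rw [hk, ← hne, h2]
        filter_upwards [hsp'] with s hs
        rw [hne] at hs
        have : N (σ s) = ‖φ (σ s)‖ := by
          simp only [hN, hk2, Real.sqrt_sq (norm_nonneg _)]
        rw [this]
        have h0 : 0 ≤ N (σ t) := Real.sqrt_nonneg _
        linarith
      · obtain ⟨-, c, hc⟩ := 𝓕.compatible q (σ t) hsrc hne
        have hNc : ∀ y, (𝓕.chart (σ t) y - c) ^ 2 = φ y ^ k → N y = ‖𝓕.chart (σ t) y - c‖ := by
          intro y hy
          simp only [hN]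
          rw [← norm_pow, ← hy, norm_pow, Real.sqrt_sq (norm_nonneg _)]
        filter_upwards [hsp', hσt.eventually hc] with s hs1 hs2
        rw [hNc _ hs2, hNc _ hc.self_of_nhds, 𝓕.chart_self]
        calc ‖𝓕.chart (σ t) (σ s) - c‖ = ‖(0 - c) + 𝓕.chart (σ t) (σ s)‖ := by ring_nf
          _ ≤ ‖0 - c‖ + ‖𝓕.chart (σ t) (σ s)‖ := norm_add_le _ _
          _ ≤ _ := by linarith
    have hopen' : φ.source ∩ N ⁻¹' Iio R ∈ 𝓝 (σ t) :=
      Filter.inter_mem (φ.open_source.mem_nhds hsrc)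
        ((hNcont.continuousAt (φ.open_source.mem_nhds hsrc)) (Iio_mem_nhds htlt))
    filter_upwards [hNstep, hσt hopen', self_mem_nhdsWithin] with s hs1 hs2 hs3
    refine ⟨hKmem _ hs2.1 (hNlt _ hs2.2).le, ?_⟩
    rw [abs_of_pos (sub_pos.2 hs3)] at hs1
    linarith)
  rintro _ ⟨t, ht, rfl⟩
  exact hKU (hsubA ht).1

/-- The radial arc from a point `y` of the stable plaque of `p` to `p`. -/
theorem exists_radial_arc (p : S) {y : S} (hy : y ∈ 𝓕.stablePlaque p) (hyp : y ≠ p)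
    (hball : Metric.closedBall 0 ‖𝓕.chart p y‖ ⊆ (𝓕.chart p).target) :
    ∃ γ : ℝ → S, Continuous γ ∧ InjOn γ (Icc 0 1) ∧ γ 0 = y ∧ γ 1 = p ∧
      (∀ t, γ t ∈ (𝓕.chart p).source ∧ ‖𝓕.chart p (γ t)‖ ≤ ‖𝓕.chart p y‖) ∧
      ∃ r : ℝ, 0 ≤ r ∧ 𝓕.NaturalLift γ (fun t => ((1 - t) * r : ℝ)) (Ico 0 1) := by
  obtain ⟨hysrc, R, hR, hyR⟩ := hy
  set φ := 𝓕.chart p with hφ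
  set k := 𝓕.prong p with hk
  have hk0 : (k : ℝ) ≠ 0 := Nat.cast_ne_zero.2 (𝓕.prong_ne_zero p)
  have hkpos : 0 < (2 : ℝ) / k := by
    have : (0 : ℝ) ≤ k := Nat.cast_nonneg k
    positivity
  -- `1 - t` clamped to `[0, 1]`, so that the path is defined and stays in the chart for all real
  -- `t`.
  set d : ℝ → ℝ := fun t => min 1 (max 0 (1 - t)) with hd
  have hd0 : ∀ t, 0 ≤ d t := fun t => le_min zero_le_one (le_max_left _ _)
  have hd1 : ∀ t, d t ≤ 1 := fun t => min_le_left _ _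
  have hdI : ∀ t ∈ Icc (0 : ℝ) 1, d t = 1 - t := by
    intro t ht
    simp only [hd]
    rw [max_eq_right (by linarith [ht.2]), min_eq_right (by linarith [ht.1])]
  -- The exponent `2 / k` makes the natural coordinate, a branch of `φ ^ (k / 2)`, linear in `t` on
  -- `[0, 1]`.
  set c : ℝ → ℝ := fun t => d t ^ ((2 : ℝ) / k) with hc
  have hccont : Continuous c := by
    have : Continuous d := by fun_prop
    exact this.rpow_const fun t => Or.inr hkpos.le
  have hc0 : ∀ t, 0 ≤ c t := fun t => Real.rpow_nonneg (hd0 t) _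
  have hc1 : ∀ t, c t ≤ 1 := fun t => Real.rpow_le_one (hd0 t) (hd1 t) hkpos.le
  have hck : ∀ t, c t ^ k = d t ^ 2 := by
    intro t
    rw [hc]
    simp only
    rw [← Real.rpow_natCast, ← Real.rpow_mul (hd0 t), div_mul_cancel₀ _ hk0]
    exact Real.rpow_natCast _ 2
  have hmem : ∀ t, (c t : ℂ) * φ y ∈ Metric.closedBall (0 : ℂ) ‖φ y‖ := by
    intro t
    rw [mem_closedBall_zero_iff, norm_mul, Complex.norm_real, Real.norm_of_nonneg (hc0 t)]
    exact mul_le_of_le_one_left (norm_nonneg _) (hc1 t)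
  set γ : ℝ → S := fun t => φ.symm (c t * φ y) with hγ
  have hγcont : Continuous γ :=
    φ.symm.continuousOn.comp_continuous (by fun_prop) fun t => hball (hmem t)
  have hφγ : ∀ t, φ (γ t) = c t * φ y := fun t => φ.right_inv (hball (hmem t))
  have hsrc : ∀ t, γ t ∈ φ.source := fun t => φ.map_target (hball (hmem t))
  have hφy : φ y ≠ 0 := fun h => hyp ((𝓕.chart_eq_zero_iff hysrc).1 h)
  have hinj : InjOn γ (Icc 0 1) := by
    intro s hs t ht hst
    have h1 : (c s : ℂ) * φ y = c t * φ y := by rw [← hφγ, ← hφγ, hst]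
    have h2 : c s = c t := by exact_mod_cast mul_right_cancel₀ hφy h1
    have h3 : d s = d t := by
      have := hck s
      rw [h2, hck t] at this
      exact ((sq_eq_sq₀ (hd0 _) (hd0 _)).1 this).symm
    rw [hdI s hs, hdI t ht] at h3
    linarith
  have hγ1 : γ 1 = p := by
    have h1 : φ (γ 1) = 0 := by
      rw [hφγ]
      simp [hc, hdI 1 (by simp), Real.zero_rpow hkpos.ne']
    exact (𝓕.chart_eq_zero_iff (hsrc 1)).1 h1
  refine ⟨γ, hγcont, hinj, ?_, hγ1, fun t => ⟨hsrc t, ?_⟩, √R, Real.sqrt_nonneg _, ?_⟩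
  · have : c 0 = 1 := by simp [hc, hdI 0 (by simp)]
    simp only [hγ, this, Complex.ofReal_one, one_mul]
    exact φ.left_inv hysrc
  · rw [hφγ]
    simpa using hmem t
  · intro t ht
    refine 𝓕.naturalLift_of_sq_eq hγcont (by fun_prop) p (fun t _ => hsrc t) ?_ t ht ?_
    · intro s hs
      have h1 : φ (γ s) ^ k = ((c s ^ k * R : ℝ) : ℂ) := by
        rw [hφγ, mul_pow, hyR]; push_cast; ring
      change _ = φ (γ s) ^ k
      rw [h1, hck, hdI s ⟨hs.1, hs.2.le⟩, ← Complex.ofReal_pow, mul_pow, Real.sq_sqrt hR]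
    · intro h
      exact ht.2.ne (hinj ⟨ht.1, ht.2.le⟩ (by simp) (h.trans hγ1.symm))

end MeasuredFoliations

/-! ### Contraction of stable arcs and invariance of stable leaves -/

namespace PseudoAnosov

variable {S T : Type*} [TopologicalSpace S] [TopologicalSpace T]

/-- A path that runs in a stable leaf shrinks under iteration. -/
theorem shrinks_of_naturalLift [T2Space S] [CompactSpace S] (F : PseudoAnosov S) {γ : ℝ → S}
    (hγ : Continuous γ) {r : ℝ} (hr : 0 ≤ r)
    (h : F.NaturalLift γ (fun t => ((1 - t) * r : ℝ)) (Ico 0 1)) :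
    Shrinks F.map (γ '' Icc 0 1) := by
  intro 𝒰 hopen hcov
  obtain ⟨δ, hδ, hsmall⟩ := F.exists_forall_speed_lt 𝒰 hopen hcov
  have hlam : 0 < F.lam := zero_lt_one.trans F.one_lt_lam
  have htend : Tendsto (fun n : ℕ => (F.lam ^ n)⁻¹ * r) atTop (𝓝 0) := by
    have := (tendsto_pow_atTop_atTop_of_one_lt F.one_lt_lam).inv_tendsto_atTop.mul_const r
    simpa using this
  filter_upwards [htend.eventually_lt_const hδ] with n hn
  have hlift := h.iterate F hγ n
  obtain ⟨U, hU, hsub⟩ := hsmall (fun t => F.map^[n] (γ t)) ((F.lam ^ n)⁻¹ * r)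
    ((F.map.continuous.iterate n).comp hγ) (by positivity) hn (by
      intro t ht
      obtain ⟨h2, ε, hε, hev⟩ := hlift t ht
      refine ⟨h2, ?_⟩
      filter_upwards [hev] with s hs
      -- The lift is real, so only the contracting factor acts: the iterated path has speed `λ⁻ⁿ r`.
      have h1 : hyperbolicMap (F.lam ^ n) ((1 - s) * r : ℝ) -
          hyperbolicMap (F.lam ^ n) ((1 - t) * r : ℝ) =
          (((F.lam ^ n)⁻¹ * r * (t - s) : ℝ) : ℂ) := by
        apply Complex.ext
        · simp only [hyperbolicMap, Complex.sub_re, Complex.ofReal_re]; ring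
        · simp only [hyperbolicMap, Complex.sub_im, Complex.ofReal_im]; ring
      rw [h1] at hs
      have h3 := congrArg norm hs
      rw [norm_mul, Complex.norm_real, Complex.norm_real, Real.norm_eq_abs, Real.norm_eq_abs,
        abs_mul, abs_of_nonneg (by positivity : 0 ≤ (F.lam ^ n)⁻¹ * r), abs_sub_comm] at h3
      have h4 : |ε| = 1 := by rcases hε with rfl | rfl <;> simp
      rw [h4, one_mul] at h3
      exact h3.symm.le)
  refine ⟨U, hU, ?_⟩
  rw [image_image]
  exact hsub

/-- A conjugacy maps stable plaques to stable plaques, locally. -/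
theorem eventually_mem_stablePlaque [T2Space S] [CompactSpace S] (F : PseudoAnosov S)
    (G : PseudoAnosov T) (h : S ≃ₜ T) (hconj : ∀ x, h (F.map x) = G.map (h x)) (p : S) :
    ∀ᶠ y in 𝓝 p, y ∈ F.stablePlaque p → h y ∈ G.stablePlaque (h p) := by
  set φ := F.chart p with hφ
  have hφ0 : φ p = 0 := F.chart_self p
  have hsrc : (F.chart p).source ∩ h ⁻¹' (G.chart (h p)).source ∈ 𝓝 p :=
    Filter.inter_mem (φ.open_source.mem_nhds (F.mem_source p))
      (h.continuous.continuousAt ((G.chart (h p)).open_source.mem_nhds (G.mem_source _)))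
  have h0 : (0 : ℂ) ∈ φ.target := hφ0 ▸ φ.map_source (F.mem_source p)
  -- The ball is taken so small that `h` carries the whole radial arc into the chart at `h p`, as
  -- the converse criterion requires.
  have hpre : φ.target ∩ φ.symm ⁻¹' (h ⁻¹' (G.chart (h p)).source) ∈ 𝓝 (0 : ℂ) := by
    refine (φ.isOpen_inter_preimage_symm
      ((G.chart (h p)).open_source.preimage h.continuous)).mem_nhds ⟨h0, ?_⟩
    rw [mem_preimage, mem_preimage, ← hφ0, φ.left_inv (F.mem_source p)]
    exact G.mem_source _
  obtain ⟨r, hr, hball⟩ := Metric.nhds_basis_closedBall.mem_iff.1 hpre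
  have hnear : ∀ᶠ y in 𝓝 p, ‖φ y‖ < r := by
    have : Tendsto (fun y => ‖φ y‖) (𝓝 p) (𝓝 ‖φ p‖) := (φ.continuousAt (F.mem_source p)).norm
    rw [hφ0, norm_zero] at this
    exact this.eventually_lt_const hr
  filter_upwards [hnear] with y hy hyp
  by_cases hne : y = p
  · subst hne
    refine ⟨G.mem_source _, 0, le_rfl, ?_⟩
    simp [G.chart_self, G.prong_ne_zero]
  obtain ⟨γ, hγ, hinj, hγ0, hγ1, hγball, s, hs, hlift⟩ := F.exists_radial_arc p hyp hne
    fun z hz => (hball (Metric.closedBall_subset_closedBall hy.le hz)).1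
  have hsh := (F.shrinks_of_naturalLift hγ hs hlift).image h hconj
  rw [image_image] at hsh
  have := G.mem_stablePlaque_of_shrinks (h p) (γ := fun t => h (γ t)) (h.continuous.comp hγ)
    (fun a ha b hb hab => hinj ha hb (h.injective hab)) (by rw [hγ1]) (fun t _ => by
      have := (hball (a := φ (γ t)) (by simpa using (hγball t).2.trans hy.le)).2
      rwa [mem_preimage, φ.left_inv (hγball t).1] at this) hsh
  rwa [hγ0] at this

/-- Leaves are defined by paths that stay in plaques locally, so the local statement about plaques
is enough. -/
theorem image_stableLeaf_subset [T2Space S] [CompactSpace S] (F : PseudoAnosov S)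
    (G : PseudoAnosov T) (h : S ≃ₜ T) (hconj : ∀ x, h (F.map x) = G.map (h x)) (x : S) :
    h '' F.stableLeaf x ⊆ G.stableLeaf (h x) := by
  rintro _ ⟨y, ⟨γ, hγ⟩, rfl⟩
  refine ⟨γ.map h.continuous, fun t => ?_⟩
  filter_upwards [hγ t, γ.continuous.continuousAt.eventually
    (F.eventually_mem_stablePlaque G h hconj (γ t))] with s hs1 hs2
  exact hs2 hs1

theorem symm_conj (F : PseudoAnosov S) (G : PseudoAnosov T) (h : S ≃ₜ T)
    (hconj : ∀ x, h (F.map x) = G.map (h x)) (y : T) :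
    h.symm (G.map y) = F.map (h.symm y) := by
  rw [h.symm_apply_eq, hconj, h.apply_symm_apply]

theorem image_stableLeaf [T2Space S] [CompactSpace S] [T2Space T] [CompactSpace T]
    (F : PseudoAnosov S) (G : PseudoAnosov T) (h : S ≃ₜ T)
    (hconj : ∀ x, h (F.map x) = G.map (h x)) (x : S) :
    h '' F.stableLeaf x = G.stableLeaf (h x) := by
  refine (F.image_stableLeaf_subset G h hconj x).antisymm fun y hy => ?_
  have := G.image_stableLeaf_subset F h.symm (F.symm_conj G h hconj) (h x) ⟨y, hy, rfl⟩
  rw [h.symm_apply_apply] at this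
  exact ⟨_, this, h.apply_symm_apply y⟩

end PseudoAnosov

/-! ### Exchanging the foliations -/

/-- A `2k`-th root of unity whose `k`-th power is `-1`, and which is `i` if `k = 2`. -/
noncomputable def quarterTurn (k : ℕ) : ℂ := Complex.exp (Real.pi * Complex.I / k)

theorem quarterTurn_ne_zero (k : ℕ) : quarterTurn k ≠ 0 := Complex.exp_ne_zero _

theorem quarterTurn_pow {k : ℕ} (hk : k ≠ 0) : quarterTurn k ^ k = -1 := by
  rw [quarterTurn, ← Complex.exp_nat_mul, mul_div_cancel₀ _ (Nat.cast_ne_zero.2 hk),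
    Complex.exp_pi_mul_I]

theorem quarterTurn_two : quarterTurn 2 = Complex.I := by
  rw [quarterTurn, Nat.cast_ofNat, mul_div_right_comm, Complex.exp_pi_div_two_mul_I]

/-- The measured foliations with the stable and the unstable one exchanged. -/
noncomputable def MeasuredFoliations.dual {S : Type*} [TopologicalSpace S]
    (𝓕 : MeasuredFoliations S) : MeasuredFoliations S where
  prong := 𝓕.prong
  prong_pos := 𝓕.prong_pos
  chart p := (𝓕.chart p).transHomeomorph
    (Homeomorph.mulLeft₀ (quarterTurn (𝓕.prong p)) (quarterTurn_ne_zero _))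
  mem_source p := 𝓕.mem_source p
  chart_self p := by simp [𝓕.chart_self]
  compatible p x hx hne := by
    obtain ⟨h2, c, hc⟩ := 𝓕.compatible p x hx hne
    -- The rotation negates `φ ^ k`, hence multiplies the natural coordinate by `± i`, which
    -- exchanges its real and imaginary parts; the translation constant turns along.
    refine ⟨h2, Complex.I * c, hc.mono fun y hy => ?_⟩
    simp only [OpenPartialHomeomorph.transHomeomorph_apply, Function.comp_apply,
      Homeomorph.coe_mulLeft₀, mul_pow]
    rw [quarterTurn_pow (𝓕.prong_ne_zero p), ← hy, h2, quarterTurn_two]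
    linear_combination (𝓕.chart x y - c) ^ 2 * Complex.I_sq

/-- The inverse of a pseudo-Anosov homeomorphism, for the exchanged foliations. -/
noncomputable def PseudoAnosov.dual {S : Type*} [TopologicalSpace S] (F : PseudoAnosov S) :
    PseudoAnosov S where
  toMeasuredFoliations := F.toMeasuredFoliations.dual
  map := F.map.symm
  lam := F.lam
  one_lt_lam := F.one_lt_lam
  prong_map x := by
    have := F.prong_map (F.map.symm x)
    rw [F.map.apply_symm_apply] at this
    exact this.symm
  expands x hx := by
    change F.prong x = 2 at hx
    have hx' : F.prong (F.map.symm x) = 2 := by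
      rw [← hx, ← F.prong_map, F.map.apply_symm_apply]
    have hlam : F.lam ≠ 0 := (zero_lt_one.trans F.one_lt_lam).ne'
    obtain ⟨ε, hε, h⟩ := F.expands _ hx'
    refine ⟨ε, hε, ?_⟩
    have htend : Tendsto F.map.symm (𝓝 x) (𝓝 (F.map.symm x)) := F.map.symm.continuous.continuousAt
    filter_upwards [htend.eventually h] with y hy
    rw [F.map.apply_symm_apply, F.map.apply_symm_apply] at hy
    have hε2 : ε * ε = 1 := by rcases hε with rfl | rfl <;> norm_num
    simp only [MeasuredFoliations.dual, OpenPartialHomeomorph.transHomeomorph_apply,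
      Function.comp_apply, Homeomorph.coe_mulLeft₀]
    rw [hx, hx', quarterTurn_two, hy]
    have h1 : F.lam * F.lam⁻¹ = 1 := mul_inv_cancel₀ hlam
    apply Complex.ext <;> simp
    · linear_combination -(F.chart (F.map.symm x) (F.map.symm y)).im * (ε * ε * h1 + hε2)
    · linear_combination -(F.chart (F.map.symm x) (F.map.symm y)).re * (ε * ε * h1 + hε2)
  sing := F.sing
  sing_eq := F.sing_eq
  sing_finite := F.sing_finite
  sing_nonempty := F.sing_nonempty
  map_sing := by
    conv_lhs => rw [← F.map_sing]
    rw [image_image]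
    simp

namespace MeasuredFoliations

variable {S : Type*} [TopologicalSpace S] (𝓕 : MeasuredFoliations S)

theorem dual_stablePlaque (p : S) : 𝓕.dual.stablePlaque p = 𝓕.unstablePlaque p := by
  ext y
  refine and_congr Iff.rfl (exists_congr fun r => and_congr_right fun _ => ?_)
  simp only [dual, OpenPartialHomeomorph.transHomeomorph_apply, Function.comp_apply,
    Homeomorph.coe_mulLeft₀, mul_pow, quarterTurn_pow (𝓕.prong_ne_zero p)]
  rw [neg_one_mul, neg_eq_iff_eq_neg, Complex.ofReal_neg]

theorem dual_stableLeaf (x : S) : 𝓕.dual.stableLeaf x = 𝓕.unstableLeaf x := by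
  simp only [stableLeaf, unstableLeaf, dual_stablePlaque]

end MeasuredFoliations

/-- `h` also conjugates the inverse maps, whose stable leaves, for the dual structures, are the
unstable leaves. -/
theorem PseudoAnosov.image_unstableLeaf {S T : Type*} [TopologicalSpace S] [TopologicalSpace T]
    [T2Space S] [CompactSpace S] [T2Space T] [CompactSpace T]
    (F : PseudoAnosov S) (G : PseudoAnosov T) (h : S ≃ₜ T)
    (hconj : ∀ x, h (F.map x) = G.map (h x)) (x : S) :
    h '' F.unstableLeaf x = G.unstableLeaf (h x) := by
  have := F.dual.image_stableLeaf G.dual h (fun x => by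
    change h (F.map.symm x) = G.map.symm (h x)
    rw [G.map.eq_symm_apply, ← hconj, F.map.apply_symm_apply]) x
  rwa [← F.dual_stableLeaf, ← G.dual_stableLeaf]

/-! ### Prongs are preserved -/

/-- A germ of injective maps that sends a star with `k'` prongs into a star with `k` prongs can only
exist if `k' ≤ k`. -/
theorem prong_le_of_injOn {k k' : ℕ} (hk : k ≠ 0) (hk' : k' ≠ 0) {u : ℂ → ℂ} {r : ℝ} (hr : 0 < r)
    (hu : ContinuousOn u (Metric.ball 0 r)) (hinj : InjOn u (Metric.ball 0 r)) (hu0 : u 0 = 0)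
    (hstar : ∀ z ∈ Metric.ball (0 : ℂ) r, (∃ ρ : ℝ, 0 ≤ ρ ∧ z ^ k' = ρ) →
      ∃ ρ : ℝ, 0 ≤ ρ ∧ u z ^ k = ρ) : k' ≤ k := by
  have h0 : (0 : ℂ) ∈ Metric.ball (0 : ℂ) r := Metric.mem_ball_self hr
  have hroot : ∀ ζ ∈ Polynomial.nthRootsFinset k' (1 : ℂ), ζ ^ k' = 1 := fun ζ hζ =>
    (Polynomial.mem_nthRootsFinset (Nat.pos_of_ne_zero hk') 1).1 hζ
  have hnorm : ∀ ζ ∈ Polynomial.nthRootsFinset k' (1 : ℂ), ‖ζ‖ = 1 := fun ζ hζ =>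
    Complex.norm_eq_one_of_pow_eq_one (hroot ζ hζ) hk'
  have hmem : ∀ ζ ∈ Polynomial.nthRootsFinset k' (1 : ℂ), ∀ t ∈ Ico (0 : ℝ) r,
      (t : ℂ) * ζ ∈ Metric.ball (0 : ℂ) r := by
    intro ζ hζ t ht
    rw [mem_ball_zero_iff, norm_mul, hnorm ζ hζ, mul_one, Complex.norm_real,
      Real.norm_of_nonneg ht.1]
    exact ht.2
  have hne : ∀ ζ ∈ Polynomial.nthRootsFinset k' (1 : ℂ), ∀ t ∈ Ioo (0 : ℝ) r,
      u (t * ζ) ≠ 0 := by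
    intro ζ hζ t ht h
    rw [← hu0] at h
    have h1 := hinj (hmem ζ hζ t ⟨ht.1.le, ht.2⟩) h0 h
    have h2 := congrArg norm h1
    rw [norm_mul, hnorm ζ hζ, mul_one, Complex.norm_real, Real.norm_of_nonneg ht.1.le, norm_zero]
      at h2
    exact ht.1.ne' h2
  have hcont : ∀ ζ ∈ Polynomial.nthRootsFinset k' (1 : ℂ),
      ContinuousOn (fun t : ℝ => u (t * ζ)) (Ico 0 r) := fun ζ hζ =>
    hu.comp (by fun_prop) (hmem ζ hζ)
  -- Prongs are indexed by roots of unity; the prong that contains an image point is given by the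
  -- direction of that point.
  have hdir : ∀ ζ ∈ Polynomial.nthRootsFinset k' (1 : ℂ), ∀ t ∈ Ioo (0 : ℝ) r,
      u (t * ζ) / ‖u (t * ζ)‖ ∈ Polynomial.nthRootsFinset k (1 : ℂ) := by
    intro ζ hζ t ht
    rw [Polynomial.mem_nthRootsFinset (Nat.pos_of_ne_zero hk)]
    obtain ⟨ρ, hρ, h⟩ := hstar _ (hmem ζ hζ t ⟨ht.1.le, ht.2⟩)
      ⟨t ^ k', pow_nonneg ht.1.le _, by rw [mul_pow, hroot ζ hζ]; push_cast; ring⟩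
    have h1 : ‖u (t * ζ)‖ ^ k = ρ := by
      rw [← norm_pow, h, Complex.norm_real, Real.norm_of_nonneg hρ]
    rw [div_pow, h, ← h1, Complex.ofReal_pow]
    exact div_self (pow_ne_zero _ (Complex.ofReal_ne_zero.2 (norm_ne_zero_iff.2 (hne ζ hζ t ht))))
  have hconst : ∀ ζ ∈ Polynomial.nthRootsFinset k' (1 : ℂ), ∀ s ∈ Ioo (0 : ℝ) r,
      ∀ t ∈ Ioo (0 : ℝ) r, u (s * ζ) / ‖u (s * ζ)‖ = u (t * ζ) / ‖u (t * ζ)‖ := by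
    intro ζ hζ s hs t ht
    have hc : ContinuousOn (fun t : ℝ => u (t * ζ) / ‖u (t * ζ)‖) (Ioo 0 r) := by
      have h1 := (hcont ζ hζ).mono Ioo_subset_Ico_self
      refine h1.div (Complex.continuous_ofReal.comp_continuousOn h1.norm) fun t ht => ?_
      exact Complex.ofReal_ne_zero.2 (norm_ne_zero_iff.2 (hne ζ hζ t ht))
    have hpre := isPreconnected_Ioo.image _ hc
    -- A connected subset of a finite set of directions is a single point, so each prong has its
    -- image in one prong.
    have hfin : ((fun t : ℝ => u (t * ζ) / ‖u (t * ζ)‖) '' Ioo 0 r).Subsingleton :=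
      (Polynomial.nthRootsFinset k (1 : ℂ)).countable_toSet.isTotallyDisconnected _
        (by rintro _ ⟨t, ht, rfl⟩; exact hdir ζ hζ t ht) hpre
    exact hfin ⟨s, hs, rfl⟩ ⟨t, ht, rfl⟩
  have hhalf : r / 2 ∈ Ioo (0 : ℝ) r := ⟨half_pos hr, half_lt_self hr⟩
  -- Distinct prongs go to distinct prongs: by the intermediate value theorem, two images in the
  -- same prong would share a point, against injectivity of `u`.
  have hcard : (Polynomial.nthRootsFinset k' (1 : ℂ)).card ≤
      (Polynomial.nthRootsFinset k (1 : ℂ)).card := by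
    refine Finset.card_le_card_of_injOn (fun ζ => u ((r / 2 : ℝ) * ζ) / ‖u ((r / 2 : ℝ) * ζ)‖)
      (fun ζ hζ => hdir ζ hζ _ hhalf) ?_
    intro ζ hζ ξ hξ hζξ
    -- both images contain a point at any small enough distance from the centre
    have hvals : ∀ ζ ∈ Polynomial.nthRootsFinset k' (1 : ℂ), ∀ a : ℝ, 0 < a →
        a ≤ ‖u ((r / 2 : ℝ) * ζ)‖ → ∃ t ∈ Ioo (0 : ℝ) r, ‖u (t * ζ)‖ = a := by
      intro ζ hζ a ha hau
      have hc : ContinuousOn (fun t : ℝ => ‖u (t * ζ)‖) (Icc 0 (r / 2)) :=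
        (hcont ζ hζ).norm.mono fun t ht => ⟨ht.1, ht.2.trans_lt hhalf.2⟩
      obtain ⟨t, ht, hta⟩ := intermediate_value_Icc hhalf.1.le hc
        (show a ∈ Icc _ _ from ⟨by simp [hu0, ha.le], hau⟩)
      refine ⟨t, ⟨ht.1.lt_of_ne ?_, ht.2.trans_lt hhalf.2⟩, hta⟩
      rintro rfl
      simp [hu0] at hta
      exact ha.ne hta
    have hpos : ∀ ζ ∈ Polynomial.nthRootsFinset k' (1 : ℂ), 0 < ‖u ((r / 2 : ℝ) * ζ)‖ :=
      fun ζ hζ => norm_pos_iff.2 (hne ζ hζ _ hhalf)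
    obtain ⟨s, hs, hsa⟩ := hvals ζ hζ _ (lt_min (hpos ζ hζ) (hpos ξ hξ)) (min_le_left _ _)
    obtain ⟨t, ht, hta⟩ := hvals ξ hξ _ (lt_min (hpos ζ hζ) (hpos ξ hξ)) (min_le_right _ _)
    have hd : u (s * ζ) / ‖u (s * ζ)‖ = u (t * ξ) / ‖u (t * ξ)‖ := by
      rw [hconst ζ hζ s hs _ hhalf, hconst ξ hξ t ht _ hhalf]
      exact hζξ
    rw [hsa, hta] at hd
    have hmin : ((min ‖u ((r / 2 : ℝ) * ζ)‖ ‖u ((r / 2 : ℝ) * ξ)‖ : ℝ) : ℂ) ≠ 0 :=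
      Complex.ofReal_ne_zero.2 (lt_min (hpos ζ hζ) (hpos ξ hξ)).ne'
    have hst := hinj (hmem ζ hζ s ⟨hs.1.le, hs.2⟩) (hmem ξ hξ t ⟨ht.1.le, ht.2⟩)
      ((div_left_inj' hmin).1 hd)
    have hst' : s = t := by
      have := congrArg norm hst
      rwa [norm_mul, norm_mul, hnorm ζ hζ, hnorm ξ hξ, mul_one, mul_one, Complex.norm_real,
        Complex.norm_real, Real.norm_of_nonneg hs.1.le, Real.norm_of_nonneg ht.1.le] at this
    rw [hst'] at hst
    exact mul_left_cancel₀ (Complex.ofReal_ne_zero.2 ht.1.ne') hst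
  rwa [(Complex.isPrimitiveRoot_exp k' hk').card_nthRootsFinset,
    (Complex.isPrimitiveRoot_exp k hk).card_nthRootsFinset] at hcard

namespace PseudoAnosov

variable {S T : Type*} [TopologicalSpace S] [TopologicalSpace T]

/-- Read in the charts at `p` and `h p`, the map `h` is an injective germ that respects the stars of
stable prongs, so `prong_le_of_injOn` applies. -/
theorem prong_le [T2Space S] [CompactSpace S] (F : PseudoAnosov S)
    (G : PseudoAnosov T) (h : S ≃ₜ T) (hconj : ∀ x, h (F.map x) = G.map (h x)) (p : S) :
    F.prong p ≤ G.prong (h p) := by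
  set φ := F.chart p with hφ
  set ψ := G.chart (h p) with hψ
  have hφ0 : φ p = 0 := F.chart_self p
  have h0 : (0 : ℂ) ∈ φ.target := hφ0 ▸ φ.map_source (F.mem_source p)
  have hsymm0 : φ.symm 0 = p := by rw [← hφ0, φ.left_inv (F.mem_source p)]
  have htend : Tendsto φ.symm (𝓝 0) (𝓝 p) := by
    have := (φ.symm.continuousAt (x := 0) h0).tendsto
    rwa [hsymm0] at this
  have hev : ∀ᶠ z in 𝓝 (0 : ℂ), z ∈ φ.target ∧ h (φ.symm z) ∈ ψ.source ∧
      (φ.symm z ∈ F.stablePlaque p → h (φ.symm z) ∈ G.stablePlaque (h p)) := by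
    have hsrc : ∀ᶠ y in 𝓝 p, h y ∈ ψ.source :=
      h.continuous.continuousAt (ψ.open_source.mem_nhds (G.mem_source _))
    filter_upwards [φ.open_target.mem_nhds h0, htend.eventually hsrc,
      htend.eventually (F.eventually_mem_stablePlaque G h hconj p)] with z h1 h2 h3
    exact ⟨h1, h2, h3⟩
  obtain ⟨r, hr, hball⟩ := Metric.eventually_nhds_iff_ball.1 hev
  refine prong_le_of_injOn (G.prong_ne_zero _) (F.prong_ne_zero _)
    (u := fun z => ψ (h (φ.symm z))) hr ?_ ?_ ?_ ?_
  · exact ψ.continuousOn.comp (h.continuous.comp_continuousOn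
      (φ.symm.continuousOn.mono fun z hz => (hball z hz).1)) fun z hz => (hball z hz).2.1
  · intro z hz z' hz' heq
    exact φ.symm.injOn (hball z hz).1 (hball z' hz').1
      (h.injective (ψ.injOn (hball z hz).2.1 (hball z' hz').2.1 heq))
  · simp only [hsymm0]
    exact G.chart_self _
  · rintro z hz ⟨ρ, hρ, hzρ⟩
    have hz1 : φ.symm z ∈ F.stablePlaque p :=
      ⟨φ.map_target (hball z hz).1, ρ, hρ, by rw [← hφ, φ.right_inv (hball z hz).1, hzρ]⟩
    exact ((hball z hz).2.2 hz1).2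

theorem prong_apply [T2Space S] [CompactSpace S] [T2Space T] [CompactSpace T] (F : PseudoAnosov S)
    (G : PseudoAnosov T) (h : S ≃ₜ T) (hconj : ∀ x, h (F.map x) = G.map (h x)) (p : S) :
    G.prong (h p) = F.prong p := by
  refine le_antisymm ?_ (F.prong_le G h hconj p)
  have := G.prong_le F h.symm (F.symm_conj G h hconj) (h p)
  rwa [h.symm_apply_apply] at this

theorem image_sing [T2Space S] [CompactSpace S] [T2Space T] [CompactSpace T] (F : PseudoAnosov S)
    (G : PseudoAnosov T) (h : S ≃ₜ T) (hconj : ∀ x, h (F.map x) = G.map (h x))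
    (hsing : (∀ p, F.prong p = 2) → h '' F.sing = G.sing) : h '' F.sing = G.sing := by
  by_cases hF : ∀ p, F.prong p = 2
  · exact hsing hF
  · obtain ⟨p, hp⟩ := not_forall.1 hF
    have hprong := F.prong_apply G h hconj
    rw [F.sing_eq ⟨p, hp⟩, G.sing_eq ⟨h p, by rwa [hprong]⟩]
    ext y
    rw [h.image_eq_preimage_symm]
    simp only [mem_preimage, mem_ofPred_eq]
    rw [← hprong, h.apply_symm_apply]

end PseudoAnosov

/-! ### Invariance of arcs, graphs, rails and rectangles under homeomorphisms -/

section Transport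

variable {S T : Type*} [TopologicalSpace S] [TopologicalSpace T] (h : S ≃ₜ T)

/-- This reduces equality of families to an equivalence of memberships. Since `h` is bijective on
points, sets and parametrizations, the quantifiers in each definition can then be moved from `T` to
`S`. -/
theorem imageFamily_eq {δ : Set (Set S)} {δ' : Set (Set T)} (H : ∀ A, h '' A ∈ δ' ↔ A ∈ δ) :
    imageFamily h δ = δ' := by
  ext B
  constructor
  · rintro ⟨A, hA, rfl⟩
    exact (H A).2 hA
  · intro hB
    obtain ⟨A, rfl⟩ := h.surjective.image_surjective B
    exact ⟨A, (H A).1 hB, rfl⟩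

theorem image_mem_imageFamily {δ : Set (Set S)} {A : Set S} : h '' A ∈ imageFamily h δ ↔ A ∈ δ :=
  h.injective.image_injective.mem_set_image

theorem Homeomorph.image_eq_of_mem_iff {s : Set S} {t : Set T} (H : ∀ x, h x ∈ t ↔ x ∈ s) :
    h '' s = t := by
  ext y
  obtain ⟨x, rfl⟩ := h.surjective y
  rw [H, h.injective.mem_set_image]

theorem sUnion_imageFamily (δ : Set (Set S)) : ⋃₀ imageFamily h δ = h '' ⋃₀ δ := by
  rw [imageFamily, image_sUnion, image_eta]

theorem imageFamily_injective : Function.Injective (imageFamily h) :=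
  h.injective.image_injective.image_injective

theorem isArc_image {A : Set S} {a b : S} : IsArc (h '' A) (h a) (h b) ↔ IsArc A a b := by
  constructor
  · rintro ⟨γ, hγ, hinj, h0, h1, hr⟩
    refine ⟨h.symm ∘ γ, h.symm.continuous.comp hγ, h.symm.injective.comp hinj, ?_, ?_, ?_⟩
    · simp [h0]
    · simp [h1]
    · rw [range_comp, hr, image_image]
      simp
  · rintro ⟨γ, hγ, hinj, rfl, rfl, rfl⟩
    exact ⟨h ∘ γ, h.continuous.comp hγ, h.injective.comp hinj, rfl, rfl, range_comp _ _⟩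

theorem arcEndpoints_image (A : Set S) : arcEndpoints (h '' A) = h '' arcEndpoints A :=
  (h.image_eq_of_mem_iff fun a => by
    simp only [arcEndpoints, mem_ofPred_eq, h.surjective.exists, isArc_image]).symm

theorem arcInterior_image (A : Set S) : arcInterior (h '' A) = h '' arcInterior A := by
  rw [arcInterior, arcInterior, arcEndpoints_image, image_sdiff h.injective]

theorem graphEndpoints_imageFamily (δ : Set (Set S)) :
    graphEndpoints (imageFamily h δ) = h '' graphEndpoints δ :=
  (h.image_eq_of_mem_iff fun a => by
    simp only [graphEndpoints, mem_ofPred_eq, h.surjective.image_surjective.exists,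
      image_mem_imageFamily, arcEndpoints_image, h.injective.mem_set_image]).symm

theorem regularPart_imageFamily (δ : Set (Set S)) :
    regularPart (imageFamily h δ) = h '' regularPart δ := by
  rw [regularPart, regularPart, sUnion_imageFamily, graphEndpoints_imageFamily,
    image_sdiff h.injective]

theorem verticalLeaf_comp (ρ : unitInterval × unitInterval → S) (s : unitInterval) :
    verticalLeaf (h ∘ ρ) s = h '' verticalLeaf ρ s :=
  range_comp h fun t => ρ (s, t)

theorem Homeomorph.comp_surjective {α : Type*} :
    Function.Surjective fun ρ : α → S => h ∘ ρ := h.surjective.comp_left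

variable {L L' : S → Set S} {M M' : T → Set T} (hL : ∀ x, h '' L x = M (h x))
  (hL' : ∀ x, h '' L' x = M' (h x))

include hL

theorem isLeafArc_image {A : Set S} {a b : S} :
    IsLeafArc M (h '' A) (h a) (h b) ↔ IsLeafArc L A a b := by
  simp only [IsLeafArc, isArc_image, h.surjective.exists, ← hL, image_subset_image_iff h.injective]

theorem generatedGraph_image (P J : Set S) :
    imageFamily h (generatedGraph L P J) = generatedGraph M (h '' P) (h '' J) :=
  imageFamily_eq h fun A => by
    simp only [generatedGraph, mem_ofPred_eq, exists_mem_image, isLeafArc_image h hL,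
      arcInterior_image, disjoint_image_iff h.injective]

theorem regularRails_imageFamily (δ : Set (Set S)) :
    imageFamily h (regularRails L δ) = regularRails M (imageFamily h δ) :=
  imageFamily_eq h fun A => by
    simp only [regularRails, mem_ofPred_eq, regularPart_imageFamily, exists_mem_image,
      isLeafArc_image h hL, arcInterior_image, sUnion_imageFamily, disjoint_image_iff h.injective]

theorem traceLeaf_image (r : Set S) (x : S) :
    traceLeaf M (h '' r) (h x) = h '' traceLeaf L r x := by
  rw [traceLeaf, traceLeaf, ← hL, ← image_inter h.injective]
  -- Outside the set `connectedComponentIn` is empty by convention, on both sides.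
  by_cases hx : x ∈ L x ∩ r
  · exact (h.image_connectedComponentIn hx).symm
  · rw [connectedComponentIn_eq_empty hx, image_empty, connectedComponentIn_eq_empty]
    rwa [h.injective.mem_set_image]

include hL'

theorem isEmbeddedRectangle_comp {ρ : unitInterval × unitInterval → S} :
    IsEmbeddedRectangle M M' (h ∘ ρ) ↔ IsEmbeddedRectangle L L' ρ := by
  simp only [IsEmbeddedRectangle, h.comp_continuous_iff, h.injective.of_comp_iff,
    h.surjective.exists, ← hL, ← hL', Function.comp_apply, h.injective.mem_set_image]

theorem extremeRails_imageFamily (δ : Set (Set S)) :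
    imageFamily h (extremeRails L L' δ) = extremeRails M M' (imageFamily h δ) :=
  imageFamily_eq h fun A => by
    simp only [extremeRails, mem_ofPred_eq, regularPart_imageFamily, arcEndpoints_image,
      exists_mem_image, h.injective.mem_set_image, (h.comp_surjective).exists,
      isEmbeddedRectangle_comp h hL hL', sUnion_imageFamily, Function.comp_apply,
      verticalLeaf_comp, h.injective.image_injective.eq_iff, ← regularRails_imageFamily h hL',
      image_mem_imageFamily]

theorem railStep_image (δ : Set (Set S)) {J J' : Set S} :
    RailStep M M' (imageFamily h δ) (h '' J) (h '' J') ↔ RailStep L L' δ J J' := by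
  simp only [RailStep, (h.comp_surjective).exists, isEmbeddedRectangle_comp h hL hL',
    sUnion_imageFamily, Function.comp_apply, verticalLeaf_comp, h.injective.image_injective.eq_iff,
    ← regularRails_imageFamily h hL', image_mem_imageFamily, h.injective.mem_set_image]

theorem eqvGen_railStep_image (δ : Set (Set S)) {J J' : Set S} :
    Relation.EqvGen (RailStep M M' (imageFamily h δ)) (h '' J) (h '' J') ↔
      Relation.EqvGen (RailStep L L' δ) J J' := by
  constructor
  · intro H
    -- The intermediate rails of a chain in `T` are not given as images, so the induction runs over
    -- arbitrary sets and pulls them back.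
    have key : ∀ B B', Relation.EqvGen (RailStep M M' (imageFamily h δ)) B B' →
        Relation.EqvGen (RailStep L L' δ) (h ⁻¹' B) (h ⁻¹' B') := by
      intro B B' H
      induction H with
      | rel B B' hB =>
        obtain ⟨A, rfl⟩ := h.surjective.image_surjective B
        obtain ⟨A', rfl⟩ := h.surjective.image_surjective B'
        rw [h.preimage_image, h.preimage_image]
        exact .rel _ _ ((railStep_image h hL hL' δ).1 hB)
      | refl B => exact .refl _
      | symm B B' _ ih => exact .symm _ _ ih
      | trans B B' B'' _ _ ih ih' => exact .trans _ _ _ ih ih'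
    simpa only [h.preimage_image] using key _ _ H
  · intro H
    induction H with
    | rel A A' hA => exact .rel _ _ ((railStep_image h hL hL' δ).2 hA)
    | refl A => exact .refl _
    | symm A A' _ ih => exact .symm _ _ ih
    | trans A A' A'' _ _ ih ih' => exact .trans _ _ _ ih ih'

theorem railClasses_imageFamily (δ : Set (Set S)) :
    imageFamily h '' railClasses L L' δ = railClasses M M' (imageFamily h δ) := by
  have hclass : ∀ J, imageFamily h {J' | Relation.EqvGen (RailStep L L' δ) J J'} =
      {J' | Relation.EqvGen (RailStep M M' (imageFamily h δ)) (h '' J) J'} := fun J =>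
    imageFamily_eq h fun J' => eqvGen_railStep_image h hL hL' δ
  ext r
  simp only [railClasses, mem_image, mem_ofPred_eq]
  constructor
  · rintro ⟨_, ⟨J, hJ, rfl⟩, rfl⟩
    refine ⟨h '' J, ?_, hclass J⟩
    rwa [← regularRails_imageFamily h hL', image_mem_imageFamily]
  · rintro ⟨B, hB, rfl⟩
    rw [← regularRails_imageFamily h hL'] at hB
    obtain ⟨J, hJ, rfl⟩ := hB
    exact ⟨_, ⟨J, hJ, rfl⟩, hclass J⟩

theorem compatible_imageFamily (δ δ' : Set (Set S)) :
    Compatible M M' (imageFamily h δ) (imageFamily h δ') ↔ Compatible L L' δ δ' := by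
  simp only [Compatible, graphEndpoints_imageFamily, sUnion_imageFamily,
    image_subset_image_iff h.injective, ← extremeRails_imageFamily h hL hL',
    ← extremeRails_imageFamily h hL' hL]
  simp only [imageFamily, forall_mem_image, image_subset_image_iff h.injective]

theorem triviallyBifoliated_image (r : Set S) :
    TriviallyBifoliated M M' (h '' r) ↔ TriviallyBifoliated L L' r := by
  simp only [TriviallyBifoliated, h.isOpen_image, h.isConnected_image, forall_mem_image,
    traceLeaf_image h hL, traceLeaf_image h hL', ← h.image_closure,
    h.surjective.exists, isArc_image, ← image_inter h.injective, ← image_singleton,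
    h.injective.image_injective.eq_iff, h.injective.mem_set_image]

theorem isSubrectangle_image {N : S → Set S} {N' : T → Set T} (hN : ∀ x, h '' N x = N' (h x))
    (c r : Set S) : IsSubrectangle M M' N' (h '' c) (h '' r) ↔ IsSubrectangle L L' N c r := by
  simp only [IsSubrectangle, triviallyBifoliated_image h hL hL',
    image_subset_image_iff h.injective, forall_mem_image, traceLeaf_image h hN,
    h.injective.image_injective.eq_iff]

end Transport

/-! ### Conjugacy invariance of graphs, compatibility and Markov partitions -/

namespace PseudoAnosov

section Conjugacy

variable {S T : Type*} [TopologicalSpace S] [TopologicalSpace T] {F : PseudoAnosov S}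
  {G : PseudoAnosov T} (h : S ≃ₜ T) (hconj : ∀ x, h (F.map x) = G.map (h x))
  (hs : ∀ x, h '' F.stableLeaf x = G.stableLeaf (h x))
  (hu : ∀ x, h '' F.unstableLeaf x = G.unstableLeaf (h x)) (hP : h '' F.sing = G.sing)

include hs hu hP in
theorem isFirstIntersection_apply_iff (z : S) :
    G.IsFirstIntersection (h z) ↔ F.IsFirstIntersection z := by
  simp only [IsFirstIntersection, ← hP, h.injective.mem_set_image, exists_mem_image,
    h.surjective.image_surjective.exists, isLeafArc_image h hs, isLeafArc_image h hu,
    ← image_singleton, ← image_sdiff h.injective, ← image_inter h.injective,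
    h.injective.image_injective.eq_iff]

include hu hP in
-- As the segment is defined as a union over all candidate arcs, uniqueness of the arc plays no
-- role.
theorem image_primitiveSegment (z : S) :
    h '' F.primitiveSegment z = G.primitiveSegment (h z) := by
  rw [primitiveSegment, primitiveSegment, ← sUnion_imageFamily]
  congr 1
  exact imageFamily_eq h fun A => by
    simp only [mem_ofPred_eq, ← hP, exists_mem_image, isLeafArc_image h hu]

include hconj hu hP in
theorem image_primitiveUnion (z : S) : h '' F.primitiveUnion z = G.primitiveUnion (h z) := by
  have hiter : ∀ i x, h (F.map.symm^[i] x) = G.map.symm^[i] (h x) := fun i x =>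
    (Function.Semiconj.iterate_right (f := h) (fun y => by
      rw [G.map.eq_symm_apply, ← hconj, F.map.apply_symm_apply]) i) x
  simp only [primitiveUnion, image_iUnion, ← image_primitiveSegment h hu hP z, image_image, hiter]

include hconj hs hu hP in
theorem imageFamily_sGraph (z : S) : imageFamily h (F.sGraph z) = G.sGraph (h z) := by
  rw [sGraph, sGraph, generatedGraph_image h hs, hP, image_primitiveUnion h hconj hu hP]

include hconj hs hu hP in
theorem imageFamily_uGraph (z : S) : imageFamily h (F.uGraph z) = G.uGraph (h z) := by
  rw [uGraph, uGraph, generatedGraph_image h hu, hP, ← sUnion_imageFamily,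
    imageFamily_sGraph h hconj hs hu hP]

include hconj hs hu hP in
theorem imageFamily_uGraphIter (z : S) (n : ℕ) :
    imageFamily h (F.uGraphIter z n) = G.uGraphIter (h z) n := by
  have hiter : ∀ i x, h (F.map^[i] x) = G.map^[i] (h x) := fun i x =>
    (Function.Semiconj.iterate_right (f := h) hconj i) x
  rw [uGraphIter, uGraphIter, ← imageFamily_uGraph h hconj hs hu hP]
  simp only [imageFamily, image_image, hiter]

include hconj hs hu hP in
theorem compatibleAt_apply_iff (z : S) (n : ℕ) : G.CompatibleAt (h z) n ↔ F.CompatibleAt z n := by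
  rw [CompatibleAt, CompatibleAt, ← imageFamily_sGraph h hconj hs hu hP,
    ← imageFamily_uGraphIter h hconj hs hu hP, compatible_imageFamily h hs hu]

include hconj hs hu hP in
theorem imageFamily_partition (z : S) (n : ℕ) :
    imageFamily h (F.partition z n) = G.partition (h z) n := by
  set X := (⋃₀ F.sGraph z ∪ ⋃₀ F.uGraphIter z n)ᶜ with hX
  have hX' : (⋃₀ G.sGraph (h z) ∪ ⋃₀ G.uGraphIter (h z) n)ᶜ = h '' X := by
    rw [← imageFamily_sGraph h hconj hs hu hP, ← imageFamily_uGraphIter h hconj hs hu hP,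
      sUnion_imageFamily, sUnion_imageFamily, ← image_union, hX, image_compl_eq h.bijective]
  rw [partition, partition, hX', ← hX]
  refine imageFamily_eq h fun A => ?_
  simp only [mem_ofPred_eq, exists_mem_image]
  refine exists_congr fun x => and_congr_right fun hx => ?_
  rw [← h.image_connectedComponentIn hx, ← h.image_closure, h.injective.image_injective.eq_iff]

include hconj hs hu in
theorem IsMarkovPartition.imageFamily {𝓡 : Set (Set S)} (H : F.IsMarkovPartition 𝓡) :
    G.IsMarkovPartition (imageFamily h 𝓡) := by
  obtain ⟨hfin, hcov, int, h1, h2, h3, h4⟩ := H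
  have hpre : ∀ X : Set S, G.map ⁻¹' (h '' X) = h '' (F.map ⁻¹' X) := fun X =>
    (h.image_eq_of_mem_iff fun x => by
      rw [mem_preimage, ← hconj, h.injective.mem_set_image, mem_preimage]).symm
  have himg : ∀ X : Set S, G.map '' (h '' X) = h '' (F.map '' X) := fun X => by
    simp only [image_image, hconj]
  -- The interiors are part of the data of a Markov partition; they are transported by pulling a
  -- rectangle back, taking its interior in `S`, and pushing forward.
  refine ⟨hfin.image _, ?_, fun B => h '' int (h ⁻¹' B), ?_, ?_, ?_, ?_⟩
  · rw [sUnion_imageFamily, hcov, image_univ, h.range_coe]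
  · rintro _ ⟨R, hR, rfl⟩
    simp only [h.preimage_image]
    exact ⟨(triviallyBifoliated_image h hs hu _).2 (h1 R hR).1,
      by rw [← h.image_closure, (h1 R hR).2]⟩
  · rintro _ ⟨R, hR, rfl⟩ _ ⟨R', hR', rfl⟩ hne
    simp only [h.preimage_image]
    exact (disjoint_image_iff h.injective).2 (h2 R hR R' hR' fun heq => hne (by rw [heq]))
  · rintro _ ⟨R, hR, rfl⟩ _ ⟨R', hR', rfl⟩
    simp only [h.preimage_image, hpre, ← image_inter h.injective, forall_mem_image]
    intro x hx
    rw [← h.image_connectedComponentIn hx]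
    exact (isSubrectangle_image h hs hu hs _ _).2 (h3 R hR R' hR' x hx)
  · rintro _ ⟨R, hR, rfl⟩ _ ⟨R', hR', rfl⟩
    simp only [h.preimage_image, himg, ← image_inter h.injective, forall_mem_image]
    intro x hx
    rw [← h.image_connectedComponentIn hx]
    exact (isSubrectangle_image h hs hu hu _ _).2 (h4 R hR R' hR' x hx)

include hconj hs hu in
theorem isMarkovPartition_imageFamily_iff (𝓡 : Set (Set S)) :
    G.IsMarkovPartition (imageFamily h 𝓡) ↔ F.IsMarkovPartition 𝓡 := by
  refine ⟨fun H => ?_, fun H => H.imageFamily h hconj hs hu⟩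
  have hsymm : ∀ {L : S → Set S} {M : T → Set T}, (∀ x, h '' L x = M (h x)) →
      ∀ y, h.symm '' M y = L (h.symm y) := by
    intro L M hL y
    rw [← h.apply_symm_apply y, ← hL, h.symm_apply_apply, image_image]
    simp
  have := H.imageFamily h.symm (F.symm_conj G h hconj) (hsymm hs) (hsymm hu)
  simpa [_root_.imageFamily, image_image] using this

end Conjugacy

end PseudoAnosov

/-! ### The proposition -/

theorem mainTheorem4
    {S T : Type*}
    [TopologicalSpace S] [T2Space S] [CompactSpace S] [ConnectedSpace S]
    [TopologicalSpace T] [T2Space T] [CompactSpace T] [ConnectedSpace T]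
    (F : PseudoAnosov S) (G : PseudoAnosov T) (h : S ≃ₜ T)
    (hconj : ∀ x, h (F.map x) = G.map (h x))
    -- only needed when the foliations have no singularity and the "singular" points are chosen
    (hsing : (∀ p, F.prong p = 2) → h '' F.sing = G.sing)
    (z : S) (hz : F.IsFirstIntersection z) :
    G.IsFirstIntersection (h z) ∧
    h '' F.primitiveUnion z = G.primitiveUnion (h z) ∧
    -- graphs
    imageFamily h (F.sGraph z) = G.sGraph (h z) ∧
    imageFamily h (F.uGraph z) = G.uGraph (h z) ∧
    -- regular and extreme rails
    imageFamily h (regularRails F.unstableLeaf (F.sGraph z)) =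
      regularRails G.unstableLeaf (G.sGraph (h z)) ∧
    imageFamily h (extremeRails F.stableLeaf F.unstableLeaf (F.sGraph z)) =
      extremeRails G.stableLeaf G.unstableLeaf (G.sGraph (h z)) ∧
    (∀ n, imageFamily h (regularRails F.stableLeaf (F.uGraphIter z n)) =
      regularRails G.stableLeaf (G.uGraphIter (h z) n)) ∧
    (∀ n, imageFamily h (extremeRails F.unstableLeaf F.stableLeaf (F.uGraphIter z n)) =
      extremeRails G.unstableLeaf G.stableLeaf (G.uGraphIter (h z) n)) ∧
    -- compatibility and its coefficient
    (∀ n, F.CompatibleAt z n ↔ G.CompatibleAt (h z) n) ∧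
    (∀ N, F.IsCompatCoeff z N ↔ G.IsCompatCoeff (h z) N) ∧
    -- classes of rails
    imageFamily h '' railClasses F.stableLeaf F.unstableLeaf (F.sGraph z) =
      railClasses G.stableLeaf G.unstableLeaf (G.sGraph (h z)) ∧
    (∀ n, imageFamily h '' railClasses F.unstableLeaf F.stableLeaf (F.uGraphIter z n) =
      railClasses G.unstableLeaf G.stableLeaf (G.uGraphIter (h z) n)) ∧
    -- Markov partitions
    (∀ n, imageFamily h (F.partition z n) = G.partition (h z) n) ∧
    (∀ n 𝓡, F.IsPrimitiveMarkovPartition z n 𝓡 ↔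
      G.IsPrimitiveMarkovPartition (h z) n (imageFamily h 𝓡)) := by
  -- These three facts contain all the geometry; what follows uses only them and the conjugacy
  -- equation.
  have hs := F.image_stableLeaf G h hconj
  have hu := F.image_unstableLeaf G h hconj
  have hP := F.image_sing G h hconj hsing
  have hfirst := PseudoAnosov.isFirstIntersection_apply_iff h hs hu hP z
  have hsG := PseudoAnosov.imageFamily_sGraph h hconj hs hu hP z
  have huG := PseudoAnosov.imageFamily_uGraphIter h hconj hs hu hP z
  have hcomp := PseudoAnosov.compatibleAt_apply_iff h hconj hs hu hP z
  have hpart := PseudoAnosov.imageFamily_partition h hconj hs hu hP z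
  have hcoeff : ∀ N, F.IsCompatCoeff z N ↔ G.IsCompatCoeff (h z) N := fun N => by
    simp only [PseudoAnosov.IsCompatCoeff, hcomp]
  refine ⟨hfirst.2 hz, PseudoAnosov.image_primitiveUnion h hconj hu hP z, hsG,
    PseudoAnosov.imageFamily_uGraph h hconj hs hu hP z, ?_, ?_, fun n => ?_, fun n => ?_,
    fun n => (hcomp n).symm, hcoeff, ?_, fun n => ?_, hpart, fun n 𝓡 => ?_⟩
  · rw [← hsG, regularRails_imageFamily h hu]
  · rw [← hsG, extremeRails_imageFamily h hs hu]
  · rw [← huG, regularRails_imageFamily h hs]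
  · rw [← huG, extremeRails_imageFamily h hu hs]
  · rw [← hsG, railClasses_imageFamily h hs hu]
  · rw [← huG, railClasses_imageFamily h hu hs]
  · simp only [PseudoAnosov.IsPrimitiveMarkovPartition, hfirst, hcoeff, ← hpart,
      (imageFamily_injective h).eq_iff,
      PseudoAnosov.isMarkovPartition_imageFamily_iff h hconj hs hu]
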